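/- Let $m\ge 1$ and let $u_1,\dots,u_m,v_1,\dots,v_m$ be real numbers with $v_i>u_i>0$ for each $i$. Put $\delta=\sum_{i=1}^m (v_i-u_i)$, write $(a)_n=a(a+1)\cdots(a+n-1)$ for the Pochhammer symbol, $\nabla g(c)=g(c)-g(c-1)$ for the backward difference, and $$p(c)=\prod_{i=1}^m (c+1-u_i),\qquad q(c)=\prod_{i=1}^m (c+2-v_i),\qquad q_1(c)=(1+c)\,q(c)-c\,q(c-1),$$ $$R_k'(\gamma)=\frac1{k!}\nabla^k p(\gamma)-\frac1{(k+1)!}\nabla^k q_1(\gamma)\qquad(0\le k\le m-1).$$ Let $(c_n)_{n\ge0}$ be given by $c_0=1$ and, for $n\ge1$, $$c_n=\frac1n\sum_{k=1}^{\min(m-1,n)}\frac{1}{(-n-\delta+1)_k}\,R'_{m-1-k}(n-k+\delta-1)\,c_{n-k}+\frac{1}{n\,(-n-\delta+1)_{m-1}}\,q(n-m+\delta-1)\,c_{n-m},$$ where the last term is present only if $n\ge m$. Then the series $\sum_{n\ge1}c_n(1-x)^n$ converges for every $0<x\le1$, and there is a probability density function $f$ on $[0,1]$ with $$\int_0^1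 x^n f(x)\,dx=\prod_{i=1}^m\frac{(u_i)_n}{(v_i)_n}\qquad(n=0,1,2,\dots)$$ and $$f(x)=\frac1{\Gamma(\delta)}\prod_{i=1}^m\frac{\Gamma(v_i)}{\Gamma(u_i)}\,(1-x)^{\delta-1}\Bigl\{1+\sum_{n=1}^\infty c_n(1-x)^n\Bigr\}$$ for all $0<x<1$, and also at $x=1$ if $\delta\ge1$. Any other density on $[0,1]$ with these moments equals $f$ almost everywhere. -/

import Mathlib

open MeasureTheory Set

noncomputable section

namespace BetaProduct

/-- The Pochhammer symbol `(a)_n = a (a + 1) ⋯ (a + n - 1)`. -/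
def poch (a : ℝ) (n : ℕ) : ℝ := (ascPochhammer ℝ n).eval a

/-- The backward difference operator `∇ g (c) = g c - g (c - 1)`. -/
def nabla (g : ℝ → ℝ) : ℝ → ℝ := fun c => g c - g (c - 1)

variable {m : ℕ}

/-- `δ = ∑ i, (v i - u i)`. -/
def delta (u v : Fin m → ℝ) : ℝ := ∑ i, (v i - u i)

/-- `p (c) = ∏ i, (c + 1 - u i)`. -/
def p (u : Fin m → ℝ) (c : ℝ) : ℝ := ∏ i, (c + 1 - u i)

/-- `q (c) = ∏ i, (c + 2 - v i)`. -/
def q (v : Fin m → ℝ) (c : ℝ) : ℝ := ∏ i, (c + 2 - v i)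

/-- `q₁ (c) = (1 + c ∇) q (c)`. -/
def q₁ (v : Fin m → ℝ) (c : ℝ) : ℝ := q v c + c * nabla (q v) c

/-- `R'_k (γ) = ∇^k p (γ) / k! - ∇^k q₁ (γ) / (k + 1)!`. -/
def R' (u v : Fin m → ℝ) (k : ℕ) (γ : ℝ) : ℝ :=
  1 / (k.factorial : ℝ) * (nabla^[k] (p u)) γ
    - 1 / ((k + 1).factorial : ℝ) * (nabla^[k] (q₁ v)) γ

/-- The `(m + 1)`-term recurrence, started at `c 0 = 1`, that determines the coefficients. -/
def IsCoeffSeq (u v : Fin m → ℝ) (c : ℕ → ℝ) : Prop :=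
  c 0 = 1 ∧ ∀ n : ℕ, 1 ≤ n →
    c n = 1 / (n : ℝ) * ∑ k ∈ Finset.Icc 1 (min (m - 1) n),
          1 / poch (-(n : ℝ) - delta u v + 1) k
            * R' u v (m - 1 - k) ((n : ℝ) - (k : ℝ) + delta u v - 1) * c (n - k)
      + (if m ≤ n then
          1 / ((n : ℝ) * poch (-(n : ℝ) - delta u v + 1) (m - 1))
            * q v ((n : ℝ) - (m : ℝ) + delta u v - 1) * c (n - m)
        else 0)

/-- `f` is a probability density function on `[0, 1]`; values outside `[0, 1]` are irrelevant. -/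
def IsDensity (f : ℝ → ℝ) : Prop :=
  (∀ x ∈ Icc (0 : ℝ) 1, 0 ≤ f x) ∧ IntegrableOn f (Icc (0 : ℝ) 1) ∧
    ∫ x in (0 : ℝ)..1, f x = 1

/-- The moments of `f` on `[0, 1]` are `∏ i, (u i)_n / (v i)_n`, for `n = 0, 1, 2, …`. -/
def HasMoments (u v : Fin m → ℝ) (f : ℝ → ℝ) : Prop :=
  ∀ n : ℕ, ∫ x in (0 : ℝ)..1, x ^ n * f x = ∏ i, poch (u i) n / poch (v i) n

end BetaProduct

end

/-! The numbers `∏ (u i)_n / (v i)_n` are the moments of a product of independent Beta(`u i`, `v i -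
u i`) variables, so the density is an iterated multiplicative convolution of beta densities.
Induction on the number of factors (`exists_isRep`) shows that it has the form `(1 - x) ^ (δ - 1) *
∑ a k * (1 - x) ^ k`, with absolute convergence for `0 < x ≤ 1`. In the inductive step
(`mulConv_betaKernel`, `hasSum_convCoeff`) the convolution integral is moved to `s ∈ (0, 1)`, where
the old series is re-expanded in `w = 1 - z` and integrated termwise.

The recurrence is read off from the moments `M`. Since `x = 1` dominates `∫ x ^ s * f x` for large
`s`, a form of Watson's lemma (`moment_sub_sum_isBigO`) gives `M s ~ ∑ a n * Γ (δ + n) * Γ (s + 1) /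
Γ (s + 1 + δ + n)`. Also `∏ (s + u i) * M s = ∏ (s + v i) * M (s + 1)`. Newton's backward
interpolation rewrites both sides in the same inverse factorial scale (`prod_mul_gammaRatio_sub`),
where coefficients are unique. Comparing them gives one linear relation for each `n`, in which `a n`
has the factor `-n` (`R'_pred`). Solving for `a n` and dividing by `a 0` gives the stated
recurrence.

Uniqueness of the density follows from Weierstrass approximation. -/

namespace BetaProduct

open Filter ProbabilityTheory Asymptotics
open scoped Topology

/-! ### Beta kernels and their moments. -/

/-- The unnormalised beta density `x ^ (α - 1) * (1 - x) ^ (β - 1)` on `(0, 1)`. -/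
noncomputable def betaKernel (α β x : ℝ) : ℝ :=
  (Ioo (0 : ℝ) 1).indicator (fun x => x ^ (α - 1) * (1 - x) ^ (β - 1)) x

lemma betaKernel_of_mem {α β x : ℝ} (hx : x ∈ Ioo (0 : ℝ) 1) :
    betaKernel α β x = x ^ (α - 1) * (1 - x) ^ (β - 1) := indicator_of_mem hx _

lemma betaKernel_of_notMem {α β x : ℝ} (hx : x ∉ Ioo (0 : ℝ) 1) : betaKernel α β x = 0 :=
  indicator_of_notMem hx _

lemma measurable_betaKernel (α β : ℝ) : Measurable (betaKernel α β) :=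
  Measurable.indicator (by fun_prop) measurableSet_Ioo

lemma betaKernel_nonneg (α β x : ℝ) : 0 ≤ betaKernel α β x := by
  refine indicator_nonneg (fun x hx => ?_) x
  exact mul_nonneg (Real.rpow_nonneg hx.1.le _) (Real.rpow_nonneg (by linarith [hx.2]) _)

lemma betaKernel_eq_mul_betaPDFReal {α β : ℝ} (hα : 0 < α) (hβ : 0 < β) (x : ℝ) :
    betaKernel α β x = beta α β * betaPDFReal α β x := by
  have := (beta_pos hα hβ).ne'
  by_cases hx : x ∈ Ioo (0 : ℝ) 1
  · rw [betaKernel_of_mem hx, betaPDFReal, if_pos ⟨hx.1, hx.2⟩]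
    field_simp
  · rw [betaKernel_of_notMem hx, betaPDFReal, if_neg (by simpa using hx), mul_zero]

lemma betaPDFReal_nonneg {α β : ℝ} (hα : 0 < α) (hβ : 0 < β) (x : ℝ) :
    0 ≤ betaPDFReal α β x := by
  by_cases hx : 0 < x ∧ x < 1
  · exact (betaPDFReal_pos hx.1 hx.2 hα hβ).le
  · rw [betaPDFReal, if_neg hx]

lemma integrable_betaKernel {α β : ℝ} (hα : 0 < α) (hβ : 0 < β) :
    Integrable (betaKernel α β) := by
  have h : Integrable (betaPDFReal α β) := by
    refine ⟨(measurable_betaPDFReal α β).aestronglyMeasurable, ?_⟩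
    rw [hasFiniteIntegral_iff_ofReal (ae_of_all _ (betaPDFReal_nonneg hα hβ))]
    have := lintegral_betaPDF_eq_one hα hβ
    simp only [betaPDF] at this
    rw [this]
    exact ENNReal.one_lt_top
  simpa only [← betaKernel_eq_mul_betaPDFReal hα hβ] using h.const_mul (beta α β)

lemma integral_betaKernel {α β : ℝ} (hα : 0 < α) (hβ : 0 < β) :
    ∫ x, betaKernel α β x = beta α β := by
  have h : ∫ x, betaPDFReal α β x = 1 := by
    rw [integral_eq_lintegral_of_nonneg_ae (ae_of_all _ (betaPDFReal_nonneg hα hβ))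
      (measurable_betaPDFReal α β).aestronglyMeasurable]
    have := lintegral_betaPDF_eq_one hα hβ
    simp only [betaPDF] at this
    rw [this, ENNReal.toReal_one]
  simp_rw [betaKernel_eq_mul_betaPDFReal hα hβ, integral_const_mul, h, mul_one]

lemma pow_mul_betaKernel (α β x : ℝ) (n : ℕ) :
    x ^ n * betaKernel α β x = betaKernel (α + n) β x := by
  by_cases hx : x ∈ Ioo (0 : ℝ) 1
  · rw [betaKernel_of_mem hx, betaKernel_of_mem hx, ← mul_assoc, ← Real.rpow_natCast x n,
      ← Real.rpow_add hx.1]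
    congr 2
    ring
  · rw [betaKernel_of_notMem hx, betaKernel_of_notMem hx, mul_zero]

/-! ### Negative binomial series and re-expansion of a composed power series. -/

/-- Negative binomial series. -/
lemma hasSum_multichoose_mul_pow (b : ℝ) {w : ℝ} (hw : |w| < 1) :
    HasSum (fun j : ℕ => Ring.multichoose b j * w ^ j) ((1 - w) ^ (-b)) := by
  have h := (Real.one_div_one_sub_rpow_hasFPowerSeriesOnBall_zero b).hasSum
    (y := w) (by simpa [enorm_eq_nnnorm, ← NNReal.coe_lt_coe] using hw)
  have hw1 : 0 < 1 - w := by linarith [(abs_lt.1 hw).2]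
  simp only [FormalMultilinearSeries.ofScalars_apply_eq, smul_eq_mul, zero_add, one_div,
    ← Real.rpow_neg hw1.le] at h
  simpa only [Ring.multichoose_eq] using h

lemma eval_ascPochhammer_eq_prod (a : ℝ) (n : ℕ) :
    (ascPochhammer ℝ n).eval a = ∏ i ∈ Finset.range n, (a + i) := by
  induction n with
  | zero => simp
  | succ n ih => rw [ascPochhammer_succ_eval, ih, Finset.prod_range_succ]

lemma multichoose_eq_prod_div (c : ℝ) (j : ℕ) :
    Ring.multichoose c j = (∏ i ∈ Finset.range j, (c + i)) / j.factorial := by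
  have h1 := Ring.factorial_nsmul_multichoose_eq_ascPochhammer c j
  rw [Polynomial.ascPochhammer_smeval_eq_eval, eval_ascPochhammer_eq_prod] at h1
  rw [← h1, nsmul_eq_mul, mul_div_cancel_left₀]
  exact_mod_cast j.factorial_ne_zero

lemma abs_multichoose_le (b : ℝ) (j : ℕ) :
    |Ring.multichoose b j| ≤ Ring.multichoose |b| j := by
  rw [multichoose_eq_prod_div, multichoose_eq_prod_div, abs_div, Finset.abs_prod, Nat.abs_cast]
  gcongr with i
  exact (abs_add_le _ _).trans_eq (by rw [Nat.abs_cast])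

lemma hasSum_sum_antidiagonal {F : ℕ × ℕ → ℝ} {S : ℝ} (h : HasSum F S) :
    HasSum (fun n => ∑ kl ∈ Finset.HasAntidiagonal.antidiagonal n, F kl) S := by
  rw [← Finset.HasAntidiagonal.sigmaAntidiagonalEquivProd.hasSum_iff] at h
  refine h.sigma fun n => ?_
  rw [← Finset.sum_finset_coe]
  exact hasSum_fintype _

/-- The coefficient of `w ^ n` in the expansion of
`∑ a k * (w * (1 - s)) ^ k * (1 - w * s) ^ (-b - k)`. -/
noncomputable def convPoly (a : ℕ → ℝ) (b : ℝ) (n : ℕ) (s : ℝ) : ℝ :=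
  ∑ kl ∈ Finset.HasAntidiagonal.antidiagonal n,
    a kl.1 * Ring.multichoose (b + kl.1) kl.2 * (1 - s) ^ kl.1 * s ^ kl.2

lemma continuous_convPoly (a : ℕ → ℝ) (b : ℝ) (n : ℕ) : Continuous (convPoly a b n) := by
  unfold convPoly
  fun_prop

lemma convPoly_zero (a : ℕ → ℝ) (b s : ℝ) : convPoly a b 0 s = a 0 := by
  simp [convPoly]

section Expansion

variable {a : ℕ → ℝ} (b : ℝ) {w s : ℝ}

lemma hasSum_convPoly_majorant (hw : w ∈ Ico (0 : ℝ) 1) (hs : s ∈ Icc (0 : ℝ) 1) (k : ℕ) :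
    HasSum (fun j => a k * Ring.multichoose (b + k) j * (w * (1 - s)) ^ k * (w * s) ^ j)
      (a k * (w * (1 - s) / (1 - w * s)) ^ k * (1 - w * s) ^ (-b)) := by
  have hws : w * s < 1 := by nlinarith [hw.1, hw.2, hs.1, hs.2]
  have h0 : 0 ≤ w * s := mul_nonneg hw.1 hs.1
  have h := (hasSum_multichoose_mul_pow (b + k) (w := w * s)
    (by rwa [abs_of_nonneg h0])).mul_left (a k * (w * (1 - s)) ^ k)
  have hp : 0 < 1 - w * s := by linarith
  have e : a k * (w * (1 - s)) ^ k * (1 - w * s) ^ (-(b + k))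
      = a k * (w * (1 - s) / (1 - w * s)) ^ k * (1 - w * s) ^ (-b) := by
    rw [neg_add, Real.rpow_add hp, Real.rpow_neg hp.le (k : ℝ), Real.rpow_natCast, div_pow]
    ring
  rw [e] at h
  convert! h using 2 with j
  ring

/-- The argument at which the old series is evaluated after the substitution stays within `[0, w]`,
so the radius of convergence does not shrink. -/
lemma ratio_le (hw : w ∈ Ico (0 : ℝ) 1) (hs : s ∈ Icc (0 : ℝ) 1) :
    0 ≤ w * (1 - s) / (1 - w * s) ∧ w * (1 - s) / (1 - w * s) ≤ w := by
  have hws : w * s < 1 := by nlinarith [hw.1, hw.2, hs.1, hs.2]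
  refine ⟨div_nonneg (mul_nonneg hw.1 (by linarith [hs.2])) (by linarith), ?_⟩
  rw [div_le_iff₀ (by linarith)]
  nlinarith [mul_nonneg (mul_nonneg hw.1 hs.1) (sub_nonneg.2 hw.2.le)]

/-- Replacing `b` by `|b|` makes every term nonnegative, so the double series can be summed by rows.
The bound is uniform in `s`, which is what termwise integration needs. -/
lemma summable_convPoly_majorant (ha : Summable fun k => |a k| * w ^ k)
    (hw : w ∈ Ico (0 : ℝ) 1) (hs : s ∈ Icc (0 : ℝ) 1) :
    (Summable fun kl : ℕ × ℕ =>
      |a kl.1| * Ring.multichoose (|b| + kl.1) kl.2 * (w * (1 - s)) ^ kl.1 * (w * s) ^ kl.2) ∧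
    ∑' kl : ℕ × ℕ,
      |a kl.1| * Ring.multichoose (|b| + kl.1) kl.2 * (w * (1 - s)) ^ kl.1 * (w * s) ^ kl.2
      ≤ (1 - w) ^ (-|b|) * ∑' k, |a k| * w ^ k := by
  set G : ℕ × ℕ → ℝ := fun kl =>
    |a kl.1| * Ring.multichoose (|b| + kl.1) kl.2 * (w * (1 - s)) ^ kl.1 * (w * s) ^ kl.2 with hG
  have hrow (k : ℕ) := hasSum_convPoly_majorant (a := fun k => |a k|) |b| hw hs k
  have hws : w * s ≤ w := mul_le_of_le_one_right hw.1 hs.2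
  have hnn : 0 ≤ G := by
    intro kl
    have : 0 ≤ Ring.multichoose (|b| + kl.1) kl.2 := by
      have h := abs_multichoose_le (|b| + kl.1) kl.2
      rw [abs_of_nonneg (by positivity : 0 ≤ |b| + kl.1)] at h
      exact (abs_nonneg _).trans h
    have h1 : 0 ≤ 1 - s := by linarith [hs.2]
    have h2 := hw.1
    have h3 := hs.1
    simp only [Pi.zero_apply, hG]
    positivity
  have hle (k : ℕ) : |a k| * (w * (1 - s) / (1 - w * s)) ^ k * (1 - w * s) ^ (-|b|)
      ≤ (1 - w) ^ (-|b|) * (|a k| * w ^ k) := by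
    rw [mul_comm ((1 - w) ^ (-|b|))]
    have h1 := ratio_le hw hs
    have h2 : (1 - w * s) ^ (-|b|) ≤ (1 - w) ^ (-|b|) :=
      Real.rpow_le_rpow_of_nonpos (by linarith [hw.2]) (by linarith) (by simp)
    have h3 : 0 ≤ (1 - w * s) ^ (-|b|) := Real.rpow_nonneg (by linarith [hw.2]) _
    have h4 := hw.1
    gcongr
    · exact h1.1
    · exact h1.2
  have hcol : Summable fun k => ∑' j, G (k, j) := by
    refine Summable.of_nonneg_of_le (fun k => tsum_nonneg fun j => hnn (k, j)) (fun k => ?_)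
      (ha.mul_left ((1 - w) ^ (-|b|)))
    exact ((hrow k).tsum_eq).le.trans (hle k)
  have hsum : Summable G := (summable_prod_of_nonneg hnn).2 ⟨fun k => (hrow k).summable, hcol⟩
  refine ⟨hsum, ?_⟩
  rw [hsum.tsum_prod, ← tsum_mul_left]
  exact hcol.tsum_le_tsum (fun k => ((hrow k).tsum_eq).le.trans (hle k))
    (ha.mul_left ((1 - w) ^ (-|b|)))

lemma convPoly_mul_pow (n : ℕ) :
    convPoly a b n s * w ^ n = ∑ kl ∈ Finset.HasAntidiagonal.antidiagonal n,
      a kl.1 * Ring.multichoose (b + kl.1) kl.2 * (w * (1 - s)) ^ kl.1 * (w * s) ^ kl.2 := by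
  rw [convPoly, Finset.sum_mul]
  refine Finset.sum_congr rfl fun kl hkl => ?_
  rw [← Finset.HasAntidiagonal.mem_antidiagonal.1 hkl, mul_pow, mul_pow]
  ring

lemma abs_convPoly_term_le (hw : w ∈ Ico (0 : ℝ) 1) (hs : s ∈ Icc (0 : ℝ) 1) (kl : ℕ × ℕ) :
    |a kl.1 * Ring.multichoose (b + kl.1) kl.2 * (w * (1 - s)) ^ kl.1 * (w * s) ^ kl.2|
      ≤ |a kl.1| * Ring.multichoose (|b| + kl.1) kl.2 * (w * (1 - s)) ^ kl.1 * (w * s) ^ kl.2 := by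
  have h1 : 0 ≤ 1 - s := by linarith [hs.2]
  have h2 := hw.1
  have h3 := hs.1
  have hmono (x y : ℝ) (hx : 0 ≤ x) (hxy : x ≤ y) (j : ℕ) :
      Ring.multichoose x j ≤ Ring.multichoose y j := by
    rw [multichoose_eq_prod_div, multichoose_eq_prod_div]
    gcongr
  rw [abs_mul, abs_mul, abs_mul, abs_of_nonneg (by positivity : 0 ≤ (w * (1 - s)) ^ kl.1),
    abs_of_nonneg (by positivity : 0 ≤ (w * s) ^ kl.2)]
  gcongr
  refine (abs_multichoose_le _ _).trans (hmono _ _ (abs_nonneg _) ?_ _)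
  exact (abs_add_le _ _).trans_eq (by rw [Nat.abs_cast])

lemma hasSum_convPoly (ha : Summable fun k => |a k| * w ^ k)
    (hw : w ∈ Ico (0 : ℝ) 1) (hs : s ∈ Icc (0 : ℝ) 1) :
    HasSum (fun n => convPoly a b n s * w ^ n)
      ((∑' k, a k * (w * (1 - s) / (1 - w * s)) ^ k) * (1 - w * s) ^ (-b)) := by
  have hsum : Summable fun kl : ℕ × ℕ =>
      a kl.1 * Ring.multichoose (b + kl.1) kl.2 * (w * (1 - s)) ^ kl.1 * (w * s) ^ kl.2 :=
    .of_norm_bounded (summable_convPoly_majorant b ha hw hs).1 (abs_convPoly_term_le b hw hs)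
  have h := hasSum_sum_antidiagonal hsum.hasSum
  simp_rw [← convPoly_mul_pow] at h
  rw [hsum.tsum_prod] at h
  simp only [(hasSum_convPoly_majorant (a := a) b hw hs _).tsum_eq, tsum_mul_right] at h
  exact h

lemma sum_abs_convPoly_le (ha : Summable fun k => |a k| * w ^ k)
    (hw : w ∈ Ico (0 : ℝ) 1) (hs : s ∈ Icc (0 : ℝ) 1) (N : ℕ) :
    ∑ n ∈ Finset.range N, |convPoly a b n s| * w ^ n
      ≤ (1 - w) ^ (-|b|) * ∑' k, |a k| * w ^ k := by
  obtain ⟨h1, h2⟩ := summable_convPoly_majorant b ha hw hs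
  have h3 := hasSum_sum_antidiagonal h1.hasSum
  refine le_trans ?_ h2
  have hle (n : ℕ) : |convPoly a b n s| * w ^ n ≤ ∑ kl ∈ Finset.HasAntidiagonal.antidiagonal n,
      |a kl.1| * Ring.multichoose (|b| + kl.1) kl.2 * (w * (1 - s)) ^ kl.1 * (w * s) ^ kl.2 := by
    rw [← abs_of_nonneg (pow_nonneg hw.1 n), ← abs_mul, convPoly_mul_pow]
    exact (Finset.abs_sum_le_sum_abs _ _).trans
      (Finset.sum_le_sum fun kl _ => abs_convPoly_term_le b hw hs kl)
  refine (Finset.sum_le_sum fun n _ => hle n).trans (sum_le_hasSum _ (fun n _ => ?_) h3)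
  exact (mul_nonneg (abs_nonneg _) (pow_nonneg hw.1 n)).trans (hle n)

end Expansion

/-! ### Termwise integration against a beta kernel. -/

/-- The power series coefficients obtained by integrating `convPoly` against a beta kernel. -/
noncomputable def convCoeff (a : ℕ → ℝ) (b d e : ℝ) (n : ℕ) : ℝ :=
  ∫ s, betaKernel d e s * convPoly a b n s

section Integrated

variable {a : ℕ → ℝ} (b : ℝ) {d e : ℝ} (hd : 0 < d) (he : 0 < e)
include hd he

lemma integrable_betaKernel_mul {h : ℝ → ℝ} (hh : Continuous h) :
    Integrable fun s => betaKernel d e s * h s := by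
  obtain ⟨C, hC⟩ := isCompact_Icc.exists_bound_of_continuousOn (s := Icc (0 : ℝ) 1)
    hh.continuousOn
  refine ((integrable_betaKernel hd he).mul_const C).mono'
    ((measurable_betaKernel d e).mul hh.measurable).aestronglyMeasurable (ae_of_all _ fun s => ?_)
  by_cases hs : s ∈ Ioo (0 : ℝ) 1
  · rw [norm_mul, Real.norm_of_nonneg (betaKernel_nonneg d e s)]
    exact mul_le_mul_of_nonneg_left (hC s (Ioo_subset_Icc_self hs)) (betaKernel_nonneg d e s)
  · simp [betaKernel_of_notMem hs]

lemma convCoeff_zero : convCoeff a b d e 0 = a 0 * beta d e := by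
  simp_rw [convCoeff, convPoly_zero, integral_mul_const, integral_betaKernel hd he, mul_comm]

lemma summable_integral_norm_convPoly {w : ℝ} (hw : w ∈ Ico (0 : ℝ) 1)
    (ha : Summable fun k => |a k| * w ^ k) :
    Summable fun n => ∫ s, ‖betaKernel d e s * (convPoly a b n s * w ^ n)‖ := by
  refine summable_of_sum_range_le (c := beta d e * ((1 - w) ^ (-|b|) * ∑' k, |a k| * w ^ k))
    (fun n => integral_nonneg fun s => norm_nonneg _) (fun N => ?_)
  have hint (n : ℕ) : Integrable fun s => betaKernel d e s * (convPoly a b n s * w ^ n) :=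
    integrable_betaKernel_mul hd he ((continuous_convPoly a b n).mul continuous_const)
  rw [← integral_finsetSum _ (fun n _ => (hint n).norm), ← integral_betaKernel hd he,
    ← integral_mul_const]
  refine integral_mono (integrable_finsetSum _ fun n _ => (hint n).norm)
    ((integrable_betaKernel hd he).mul_const _) fun s => ?_
  by_cases hs : s ∈ Ioo (0 : ℝ) 1
  · have h := mul_le_mul_of_nonneg_left
      (sum_abs_convPoly_le b ha hw (Ioo_subset_Icc_self hs) N) (betaKernel_nonneg d e s)
    rw [Finset.mul_sum] at h
    simpa only [norm_mul, Real.norm_of_nonneg (betaKernel_nonneg d e s), Real.norm_eq_abs,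
      abs_of_nonneg (pow_nonneg hw.1 _)] using h
  · simp [betaKernel_of_notMem hs]

lemma summable_abs_convCoeff {w : ℝ} (hw : w ∈ Ico (0 : ℝ) 1)
    (ha : Summable fun k => |a k| * w ^ k) :
    Summable fun n => |convCoeff a b d e n| * w ^ n := by
  refine (summable_integral_norm_convPoly b hd he hw ha).of_nonneg_of_le
    (fun n => mul_nonneg (abs_nonneg _) (pow_nonneg hw.1 n)) (fun n => ?_)
  refine le_trans ?_ (norm_integral_le_integral_norm _)
  simp_rw [← mul_assoc, integral_mul_const, norm_mul, Real.norm_eq_abs]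
  rw [abs_of_nonneg (pow_nonneg hw.1 n)]
  rfl

lemma hasSum_convCoeff {w : ℝ} (hw : w ∈ Ico (0 : ℝ) 1)
    (ha : Summable fun k => |a k| * w ^ k) :
    HasSum (fun n => convCoeff a b d e n * w ^ n)
      (∫ s, betaKernel d e s *
        ((∑' k, a k * (w * (1 - s) / (1 - w * s)) ^ k) * (1 - w * s) ^ (-b))) := by
  have h := hasSum_integral_of_summable_integral_norm
    (F := fun n s => betaKernel d e s * (convPoly a b n s * w ^ n)) (fun n =>
    integrable_betaKernel_mul hd he ((continuous_convPoly a b n).mul continuous_const))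
    (summable_integral_norm_convPoly b hd he hw ha)
  convert! h using 1
  · ext n
    simp_rw [← mul_assoc, integral_mul_const]
    rfl
  · refine integral_congr_ae (ae_of_all _ fun s => ?_)
    by_cases hs : s ∈ Ioo (0 : ℝ) 1
    · simp only [tsum_mul_left, (hasSum_convPoly b ha hw (Ioo_subset_Icc_self hs)).tsum_eq]
    · simp [betaKernel_of_notMem hs]

end Integrated

/-! ### Multiplicative convolution. -/

/-- Multiplicative convolution of two functions supported on `(0, 1)`. -/
noncomputable def mulConv (f g : ℝ → ℝ) (z : ℝ) : ℝ := ∫ x, f (z / x) * (g x / x)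

section MulConv

variable {f g : ℝ → ℝ}

lemma measurable_mulConv_integrand (hf : Measurable f) (hg : Measurable g) :
    Measurable fun zx : ℝ × ℝ => f (zx.1 / zx.2) * (g zx.2 / zx.2) :=
  (hf.comp (measurable_fst.div measurable_snd)).mul
    ((hg.comp measurable_snd).div measurable_snd)

lemma measurable_mulConv (hf : Measurable f) (hg : Measurable g) : Measurable (mulConv f g) :=
  (measurable_mulConv_integrand hf hg).stronglyMeasurable.integral_prod_right.measurable

lemma mulConv_nonneg (hf : ∀ x, 0 ≤ f x) (hg : ∀ x, 0 ≤ g x)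
    (hg0 : ∀ x ∉ Ioo (0 : ℝ) 1, g x = 0) (z : ℝ) : 0 ≤ mulConv f g z := by
  refine integral_nonneg fun x => mul_nonneg (hf _) ?_
  by_cases hx : x ∈ Ioo (0 : ℝ) 1
  · exact div_nonneg (hg x) hx.1.le
  · simp [hg0 x hx]

lemma mulConv_eq_zero (hf0 : ∀ x ∉ Ioo (0 : ℝ) 1, f x = 0)
    (hg0 : ∀ x ∉ Ioo (0 : ℝ) 1, g x = 0) {z : ℝ} (hz : z ∉ Ioo (0 : ℝ) 1) :
    mulConv f g z = 0 := by
  refine integral_eq_zero_of_ae (ae_of_all _ fun x => ?_)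
  by_cases hx : x ∈ Ioo (0 : ℝ) 1
  · simp only [Pi.zero_apply]
    rw [hf0, zero_mul]
    rintro ⟨h1, h2⟩
    rw [div_lt_one hx.1] at h2
    exact hz ⟨by simpa [div_mul_cancel₀ _ hx.1.ne'] using mul_pos h1 hx.1, h2.trans hx.2⟩
  · simp [hg0 x hx]

lemma integrable_pow_mul {f : ℝ → ℝ} (hf : Integrable f)
    (hf0 : ∀ x ∉ Ioo (0 : ℝ) 1, f x = 0) (n : ℕ) : Integrable fun x => x ^ n * f x := by
  refine hf.norm.mono' ((continuous_pow n).aestronglyMeasurable.mul hf.1) (ae_of_all _ fun x => ?_)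
  by_cases hx : x ∈ Ioo (0 : ℝ) 1
  · rw [norm_mul, norm_pow, Real.norm_of_nonneg hx.1.le]
    exact mul_le_of_le_one_left (norm_nonneg _) (pow_le_one₀ hx.1.le hx.2.le)
  · simp [hf0 x hx]

/-- The weight splits as `z ^ n = (z / x) ^ n * x ^ n`; multiplicativity of all moments thus reduces
to that of the total mass. -/
lemma pow_mul_mulConv (n : ℕ) (hg0 : ∀ x ∉ Ioo (0 : ℝ) 1, g x = 0) (z : ℝ) :
    z ^ n * mulConv f g z = mulConv (fun x => x ^ n * f x) (fun x => x ^ n * g x) z := by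
  rw [mulConv, mulConv, ← integral_const_mul]
  congr 1 with x
  by_cases hx : x ∈ Ioo (0 : ℝ) 1
  · rw [div_pow]
    have := hx.1.ne'
    field_simp
  · simp [hg0 x hx]

lemma integrable_mulConv_integrand (hf : Integrable f) (hg : Integrable g)
    (hfm : Measurable f) (hgm : Measurable g) (hg0 : ∀ x ∉ Ioo (0 : ℝ) 1, g x = 0) :
    Integrable fun zx : ℝ × ℝ => f (zx.1 / zx.2) * (g zx.2 / zx.2) := by
  rw [show (volume : Measure (ℝ × ℝ)) = (volume : Measure ℝ).prod volume from rfl,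
    integrable_prod_iff' (measurable_mulConv_integrand hfm hgm).aestronglyMeasurable]
  refine ⟨ae_of_all _ fun x => ?_, ?_⟩
  · by_cases hx : x ∈ Ioo (0 : ℝ) 1
    · exact (hf.comp_div hx.1.ne').mul_const (g x / x)
    · simp [hg0 x hx]
  · refine (hg.norm.const_mul (∫ y, ‖f y‖)).congr (ae_of_all _ fun x => ?_)
    by_cases hx : x ∈ Ioo (0 : ℝ) 1
    · simp only [norm_mul, norm_div, integral_mul_const]
      rw [Measure.integral_comp_div (fun y => ‖f y‖), Real.norm_eq_abs x, smul_eq_mul]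
      have := (abs_pos.2 hx.1.ne').ne'
      field_simp
    · simp [hg0 x hx]

lemma integral_mulConv (hf : Integrable f) (hg : Integrable g)
    (hfm : Measurable f) (hgm : Measurable g) (hg0 : ∀ x ∉ Ioo (0 : ℝ) 1, g x = 0) :
    ∫ z, mulConv f g z = (∫ x, f x) * ∫ x, g x := by
  simp only [mulConv]
  rw [integral_integral_swap (integrable_mulConv_integrand hf hg hfm hgm hg0),
    ← integral_const_mul]
  congr 1 with x
  by_cases hx : x ∈ Ioo (0 : ℝ) 1
  · rw [integral_mul_const, Measure.integral_comp_div, abs_of_pos hx.1, smul_eq_mul]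
    have := hx.1.ne'
    field_simp
  · simp [hg0 x hx]

lemma integrable_mulConv (hf : Integrable f) (hg : Integrable g)
    (hfm : Measurable f) (hgm : Measurable g) (hg0 : ∀ x ∉ Ioo (0 : ℝ) 1, g x = 0) :
    Integrable (mulConv f g) :=
  (integrable_mulConv_integrand hf hg hfm hgm hg0).integral_prod_left

/-- Substitute `x = 1 - (1 - z) * s`, which maps `s ∈ (0, 1)` onto `x ∈ (z, 1)`. The powers of `x`
come from `1 - z / x`, from the kernel and from `1 / x`; together they give the exponent `-(δ + 1 -
u)`. -/
lemma mulConv_betaKernel {a : ℕ → ℝ} {δ u d : ℝ}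
    (hf0 : ∀ x ∉ Ioo (0 : ℝ) 1, f x = 0)
    (hf : ∀ x ∈ Ioo (0 : ℝ) 1, f x = (1 - x) ^ (δ - 1) * ∑' k, a k * (1 - x) ^ k)
    {z : ℝ} (hz : z ∈ Ioo (0 : ℝ) 1) :
    mulConv f (betaKernel u d) z = (1 - z) ^ (δ + d - 1) *
      ∫ s, betaKernel d δ s * ((∑' k, a k * ((1 - z) * (1 - s) / (1 - (1 - z) * s)) ^ k)
        * (1 - (1 - z) * s) ^ (-(δ + 1 - u))) := by
  have hw : 0 < 1 - z := by linarith [hz.2]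
  have e1 : mulConv f (betaKernel u d) z = (1 - z) * ∫ s, f (z / (1 - (1 - z) * s)) *
      (betaKernel u d (1 - (1 - z) * s) / (1 - (1 - z) * s)) := by
    rw [Measure.integral_comp_mul_left (fun y => f (z / (1 - y)) *
      (betaKernel u d (1 - y) / (1 - y))), integral_sub_left_eq_self
      (fun x => f (z / x) * (betaKernel u d x / x)), abs_of_pos (inv_pos.2 hw), smul_eq_mul,
      mul_inv_cancel_left₀ hw.ne', mulConv]
  rw [e1, ← integral_const_mul, ← integral_const_mul]
  congr 1 with s
  set x := 1 - (1 - z) * s with hx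
  by_cases hs : s ∈ Ioo (0 : ℝ) 1
  · have hxz : z < x := by nlinarith [hs.2]
    have hx1 : x < 1 := by nlinarith [hs.1]
    have hx0 : 0 < x := hz.1.trans hxz
    have h1s : 0 < 1 - s := by linarith [hs.2]
    have hzx : 1 - z / x = (1 - z) * (1 - s) / x := by
      rw [eq_div_iff hx0.ne', sub_mul, div_mul_cancel₀ _ hx0.ne', hx]
      ring
    have hxp : x ^ (-(δ + 1 - u)) = x ^ (u - 1) / x ^ (δ - 1) / x := by
      rw [show -(δ + 1 - u) = (u - 1) - (δ - 1) - 1 by ring, Real.rpow_sub_one hx0.ne',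
        Real.rpow_sub hx0]
    rw [hf (z / x) ⟨div_pos hz.1 hx0, (div_lt_one hx0).2 hxz⟩, hzx,
      betaKernel_of_mem ⟨hx0, hx1⟩, betaKernel_of_mem hs, show 1 - x = (1 - z) * s by simp [hx],
      Real.div_rpow (by positivity) hx0.le, Real.mul_rpow hw.le h1s.le,
      Real.mul_rpow hw.le hs.1.le,
      show δ + d - 1 = (δ - 1) + (d - 1) + 1 by ring, Real.rpow_add_one hw.ne',
      Real.rpow_add hw, hxp]
    ring
  · rw [betaKernel_of_notMem hs, zero_mul, mul_zero]
    -- For `s ∉ (0, 1)` but `x ∈ (0, 1)` one has `s ≥ 1`, hence `x ≤ z`, and `f` vanishes at `z / x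
    -- ≥ 1`.
    by_cases hx01 : x ∈ Ioo (0 : ℝ) 1
    · have h0 : 0 < s := by nlinarith [hx01.2]
      have h1 : 1 ≤ s := not_lt.1 fun h => hs ⟨h0, h⟩
      rw [hf0 (z / x), zero_mul, mul_zero]
      rintro ⟨-, h⟩
      rw [div_lt_one hx01.1] at h
      nlinarith
    · rw [betaKernel_of_notMem hx01, zero_div, mul_zero, mul_zero]

end MulConv

/-! ### Existence of the power series representation. -/

/-- `f` is a nonnegative function on `(0, 1)` with moments `M`, of the form
`(1 - x) ^ (δ - 1) * ∑ a k * (1 - x) ^ k`. -/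
structure IsRep (M : ℕ → ℝ) (δ : ℝ) (a : ℕ → ℝ) (f : ℝ → ℝ) : Prop where
  measurable : Measurable f
  eq_zero : ∀ x ∉ Ioo (0 : ℝ) 1, f x = 0
  nonneg : ∀ x, 0 ≤ f x
  integrable : Integrable f
  moment : ∀ n : ℕ, ∫ x, x ^ n * f x = M n
  summable : ∀ w ∈ Ico (0 : ℝ) 1, Summable fun k => |a k| * w ^ k
  eq_tsum : ∀ x ∈ Ioo (0 : ℝ) 1, f x = (1 - x) ^ (δ - 1) * ∑' k, a k * (1 - x) ^ k

namespace IsRep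

lemma const_mul {M : ℕ → ℝ} {δ : ℝ} {a : ℕ → ℝ} {f : ℝ → ℝ} (h : IsRep M δ a f) {C : ℝ}
    (hC : 0 ≤ C) : IsRep (fun n => C * M n) δ (fun n => C * a n) (fun x => C * f x) where
  measurable := h.measurable.const_mul C
  eq_zero x hx := by rw [h.eq_zero x hx, mul_zero]
  nonneg x := mul_nonneg hC (h.nonneg x)
  integrable := h.integrable.const_mul C
  moment n := by simp_rw [mul_left_comm _ C, integral_const_mul, h.moment]
  summable w hw := by
    simpa only [abs_mul, mul_assoc] using (h.summable w hw).mul_left |C|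
  eq_tsum x hx := by simp_rw [h.eq_tsum x hx, mul_assoc C, tsum_mul_left, mul_left_comm C]

lemma betaKernel {u d : ℝ} (hu : 0 < u) (hd : 0 < d) :
    IsRep (fun n => beta (u + n) d) d (Ring.multichoose (1 - u)) (betaKernel u d) where
  measurable := measurable_betaKernel u d
  eq_zero x hx := betaKernel_of_notMem hx
  nonneg := betaKernel_nonneg u d
  integrable := integrable_betaKernel hu hd
  moment n := by
    simp_rw [pow_mul_betaKernel]
    exact integral_betaKernel (by positivity) hd
  summable w hw := by
    have h := (hasSum_multichoose_mul_pow |1 - u| (by rw [abs_of_nonneg hw.1]; exact hw.2 : |w| < 1)).summable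
    refine h.of_nonneg_of_le (fun k => mul_nonneg (abs_nonneg _) (pow_nonneg hw.1 k)) fun k => ?_
    exact mul_le_mul_of_nonneg_right (abs_multichoose_le _ _) (pow_nonneg hw.1 k)
  eq_tsum x hx := by
    rw [betaKernel_of_mem hx, (hasSum_multichoose_mul_pow (1 - u) (w := 1 - x)
      (by rw [abs_of_pos] <;> linarith [hx.1, hx.2])).tsum_eq, mul_comm]
    congr 2 <;> ring

lemma mulConv {M : ℕ → ℝ} {δ : ℝ} {a : ℕ → ℝ} {f : ℝ → ℝ} (h : IsRep M δ a f) (hδ : 0 < δ)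
    {u d : ℝ} (hu : 0 < u) (hd : 0 < d) :
    IsRep (fun n => M n * beta (u + n) d) (δ + d) (convCoeff a (δ + 1 - u) d δ)
      (mulConv f (BetaProduct.betaKernel u d)) := by
  have hg := IsRep.betaKernel hu hd
  refine ⟨measurable_mulConv h.measurable hg.measurable,
    fun x hx => mulConv_eq_zero h.eq_zero hg.eq_zero hx,
    mulConv_nonneg h.nonneg hg.nonneg hg.eq_zero,
    integrable_mulConv h.integrable hg.integrable h.measurable hg.measurable hg.eq_zero,
    fun n => ?_, fun w hw => summable_abs_convCoeff _ hd hδ hw (h.summable w hw), fun x hx => ?_⟩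
  · simp_rw [pow_mul_mulConv n hg.eq_zero]
    rw [integral_mulConv (integrable_pow_mul h.integrable h.eq_zero n)
      (integrable_pow_mul hg.integrable hg.eq_zero n)
      ((measurable_id.pow_const n).mul h.measurable)
      ((measurable_id.pow_const n).mul hg.measurable) fun x hx => by rw [hg.eq_zero x hx, mul_zero],
      h.moment, hg.moment]
  · have hw : 1 - x ∈ Ico (0 : ℝ) 1 := ⟨by linarith [hx.2], by linarith [hx.1]⟩
    rw [mulConv_betaKernel h.eq_zero h.eq_tsum hx,
      (hasSum_convCoeff (δ + 1 - u) hd hδ hw (h.summable _ hw)).tsum_eq]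

end IsRep

lemma poch_succ (a : ℝ) (n : ℕ) : poch a (n + 1) = poch a n * (a + n) :=
  ascPochhammer_succ_eval n a

lemma poch_pos {a : ℝ} (ha : 0 < a) (n : ℕ) : 0 < poch a n := ascPochhammer_pos n a ha

lemma Gamma_add_nat {a : ℝ} (ha : 0 < a) (n : ℕ) :
    Real.Gamma (a + n) = poch a n * Real.Gamma a := by
  induction n with
  | zero => simp [poch]
  | succ n ih =>
    rw [Nat.cast_succ, ← add_assoc, Real.Gamma_add_one (by positivity), ih, poch_succ]
    ring

lemma beta_add_nat_div {u v : ℝ} (hu : 0 < u) (huv : u < v) (n : ℕ) :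
    (beta u (v - u))⁻¹ * beta (u + n) (v - u) = poch u n / poch v n := by
  have hv := hu.trans huv
  have h1 := (poch_pos hv n).ne'
  have h2 := (Real.Gamma_pos_of_pos hu).ne'
  have h3 := (Real.Gamma_pos_of_pos hv).ne'
  have h4 := (Real.Gamma_pos_of_pos (sub_pos.2 huv)).ne'
  rw [beta, beta, show u + n + (v - u) = v + n by ring, show u + (v - u) = v by ring,
    Gamma_add_nat hu, Gamma_add_nat hv]
  field_simp

lemma delta_pos {m : ℕ} {u v : Fin (m + 1) → ℝ} (huv : ∀ i, 0 < u i ∧ u i < v i) :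
    0 < delta u v :=
  Finset.sum_pos (fun i _ => sub_pos.2 (huv i).2) Finset.univ_nonempty

/-- Each step convolves with one normalised beta density. The leading coefficient gets multiplied by
`B(d, δ)`, whose `Γ (δ)` cancels the old prefactor and whose `Γ (δ + d)` supplies the new one. -/
theorem exists_isRep (m : ℕ) (u v : Fin (m + 1) → ℝ) (huv : ∀ i, 0 < u i ∧ u i < v i) :
    ∃ a f, IsRep (fun n => ∏ i, poch (u i) n / poch (v i) n) (delta u v) a f ∧
      a 0 = 1 / Real.Gamma (delta u v) * ∏ i, Real.Gamma (v i) / Real.Gamma (u i) := by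
  induction m with
  | zero =>
    obtain ⟨hu, huv⟩ := huv 0
    have hd := sub_pos.2 huv
    refine ⟨_, _, by simpa [delta, beta_add_nat_div hu huv] using
      (IsRep.betaKernel hu hd).const_mul (inv_nonneg.2 (beta_pos hu hd).le), ?_⟩
    simp [delta, beta, div_eq_mul_inv]
    ring
  | succ m ih =>
    obtain ⟨a, f, h, ha⟩ := ih (fun i => u i.succ) (fun i => v i.succ) fun i => huv i.succ
    have hδ := delta_pos (u := fun i => u i.succ) (v := fun i => v i.succ) fun i => huv i.succ
    obtain ⟨hu, huv⟩ := huv 0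
    have hd := sub_pos.2 huv
    have hδ' : delta u v = delta (fun i => u i.succ) (fun i => v i.succ) + (v 0 - u 0) := by
      rw [delta, Fin.sum_univ_succ, add_comm, delta]
    have hM (n : ℕ) : (beta (u 0) (v 0 - u 0))⁻¹ *
        ((∏ i, poch (u (Fin.succ i)) n / poch (v (Fin.succ i)) n) * beta (u 0 + n) (v 0 - u 0))
        = ∏ i, poch (u i) n / poch (v i) n := by
      rw [Fin.prod_univ_succ (fun i => poch (u i) n / poch (v i) n), ← beta_add_nat_div hu huv]
      ring
    have h' := (h.mulConv hδ hu hd).const_mul (inv_nonneg.2 (beta_pos hu hd).le)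
    rw [← hδ', funext hM] at h'
    refine ⟨_, _, h', ?_⟩
    have h2 := (Real.Gamma_pos_of_pos hu).ne'
    have h3 := (Real.Gamma_pos_of_pos (hu.trans huv)).ne'
    have h4 := (Real.Gamma_pos_of_pos hd).ne'
    have h5 := (Real.Gamma_pos_of_pos hδ).ne'
    rw [convCoeff_zero _ hd hδ, ha, hδ', Fin.prod_univ_succ (fun i => Real.Gamma (v i) / Real.Gamma (u i)),
      beta, beta,
      show u 0 + (v 0 - u 0) = v 0 by ring, add_comm (v 0 - u 0)]
    field_simp

/-! ### Backward differences and Newton interpolation. -/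

section Newton

lemma nabla_iterate_succ (g : ℝ → ℝ) (k : ℕ) (c : ℝ) :
    nabla^[k + 1] g c = nabla^[k] g c - nabla^[k] g (c - 1) := by
  rw [Function.iterate_succ_apply', nabla]

/-- Product rule for iterated backward differences with a linear factor. -/
lemma nabla_iterate_linear_mul (g : ℝ → ℝ) (r : ℝ) (k : ℕ) (c : ℝ) :
    nabla^[k + 1] (fun c => (c + r) * g c) c
      = (c + r - (k + 1)) * nabla^[k + 1] g c + (k + 1) * nabla^[k] g c := by
  induction k generalizing c with
  | zero => simp [nabla]; ring
  | succ k ih =>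
    rw [nabla_iterate_succ, ih, ih, nabla_iterate_succ g (k + 1), nabla_iterate_succ g k c,
      nabla_iterate_succ g k (c - 1)]
    push_cast
    ring

lemma nabla_iterate_prod_eq_zero {n k : ℕ} (r : Fin n → ℝ) (hk : n < k) (c : ℝ) :
    nabla^[k] (fun c => ∏ i, (c + r i)) c = 0 := by
  obtain ⟨k, rfl⟩ := Nat.exists_eq_add_of_lt hk
  clear hk
  induction n generalizing k c with
  | zero =>
    have h0 : nabla (fun _ => 0) = fun _ => 0 := by ext; simp [nabla]
    have h1 : nabla (fun _ => 1) = fun _ => 0 := by ext; simp [nabla]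
    simp only [Finset.univ_eq_empty, Finset.prod_empty, zero_add]
    rw [Function.iterate_succ_apply, h1, Function.iterate_fixed h0]
  | succ n ih =>
    simp_rw [Fin.prod_univ_succ]
    rw [nabla_iterate_linear_mul]
    have h1 := ih (fun i => r i.succ) c k
    have h2 := ih (fun i => r i.succ) c (k + 1)
    rw [show n + 1 + k = n + k + 1 by lia, h1, show n + k + 1 + 1 = n + (k + 1) + 1 by lia, h2]
    ring

lemma nabla_iterate_prod {n : ℕ} (r : Fin n → ℝ) (c : ℝ) :
    nabla^[n] (fun c => ∏ i, (c + r i)) c = n.factorial := by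
  induction n with
  | zero => simp
  | succ n ih =>
    simp_rw [Fin.prod_univ_succ]
    rw [nabla_iterate_linear_mul, ih fun i => r i.succ,
      nabla_iterate_prod_eq_zero (fun i => r i.succ) n.lt_succ_self, Nat.factorial_succ]
    push_cast
    ring

lemma nabla_iterate_prod_succ {n : ℕ} (r : Fin (n + 1) → ℝ) (c : ℝ) :
    nabla^[n] (fun c => ∏ i, (c + r i)) c
      = n.factorial * (∑ i, r i + (n + 1) * c - n * (n + 1) / 2) := by
  induction n with
  | zero => simp; ring
  | succ n ih =>
    simp_rw [Fin.prod_univ_succ (n := n + 1)]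
    rw [nabla_iterate_linear_mul, ih fun i => r i.succ,
      nabla_iterate_prod fun i => r (Fin.succ i), Fin.sum_univ_succ (n := n + 1),
      Nat.factorial_succ]
    push_cast
    ring

/-- Inductive step of Newton's formula. With `T k` the `k`-th summand on the left, the product rule
makes the `(k + 1)`-th summand on the right `(γ - y + r) * T k` plus the increment of `(γ + r - k) *
T k`. The increments telescope; `hg` removes the upper end, and the lower end cancels the zeroth
summand. -/
lemma linear_mul_sum_nabla {n : ℕ} {g : ℝ → ℝ} {γ : ℝ} (hg : nabla^[n + 1] g γ = 0) (r y : ℝ) :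
    (γ - y + r) * ∑ k ∈ Finset.range (n + 1),
      (-1) ^ k / (k.factorial : ℝ) * nabla^[k] g γ * (descPochhammer ℝ k).eval y
    = ∑ k ∈ Finset.range (n + 1 + 1), (-1) ^ k / (k.factorial : ℝ)
        * nabla^[k] (fun c => (c + r) * g c) γ * (descPochhammer ℝ k).eval y := by
  have e (k : ℕ) : (-1) ^ (k + 1) / ((k + 1).factorial : ℝ)
      * nabla^[k + 1] (fun c => (c + r) * g c) γ * (descPochhammer ℝ (k + 1)).eval y
      = (γ - y + r) * ((-1) ^ k / (k.factorial : ℝ) * nabla^[k] g γ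
          * (descPochhammer ℝ k).eval y)
        + ((γ + r - (k + 1 : ℕ)) * ((-1) ^ (k + 1) / ((k + 1).factorial : ℝ)
            * nabla^[k + 1] g γ * (descPochhammer ℝ (k + 1)).eval y)
          - (γ + r - k) * ((-1) ^ k / (k.factorial : ℝ)
            * nabla^[k] g γ * (descPochhammer ℝ k).eval y)) := by
    rw [nabla_iterate_linear_mul, descPochhammer_succ_eval, Nat.factorial_succ]
    have := k.factorial_ne_zero
    push_cast
    field_simp
    ring
  rw [Finset.sum_range_succ' (n := n + 1)]
  simp_rw [e]
  rw [Finset.sum_add_distrib, Finset.sum_range_sub (fun k : ℕ => (γ + r - k) *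
    ((-1) ^ k / (k.factorial : ℝ) * nabla^[k] g γ * (descPochhammer ℝ k).eval y)), hg,
    Finset.mul_sum]
  simp

/-- Newton's backward interpolation formula for a product of linear factors. -/
lemma prod_sub_eq_sum_nabla {n : ℕ} (r : Fin n → ℝ) (γ y : ℝ) :
    ∏ i, (γ - y + r i) = ∑ k ∈ Finset.range (n + 1),
      (-1) ^ k / (k.factorial : ℝ) * nabla^[k] (fun c => ∏ i, (c + r i)) γ
        * (descPochhammer ℝ k).eval y := by
  induction n with
  | zero => simp
  | succ n ih =>
    simp_rw [Fin.prod_univ_succ (n := n)]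
    rw [ih fun i => r i.succ]
    exact linear_mul_sum_nabla
      (nabla_iterate_prod_eq_zero (fun i => r i.succ) n.lt_succ_self γ) (r 0) y

end Newton

/-! ### The coefficients `R'`. -/

section Difference

variable {m : ℕ} (u v : Fin m → ℝ)

lemma p_eq : p u = fun c => ∏ i, (c + (1 - u i)) := by
  ext c
  simp only [p, add_sub_assoc]

lemma q_eq : q v = fun c => ∏ i, (c + (2 - v i)) := by
  ext c
  simp only [q, add_sub_assoc]

lemma nabla_iterate_q₁ (k : ℕ) (c : ℝ) :
    nabla^[k] (q₁ v) c = (k + 1) * nabla^[k] (q v) c + (c - k) * nabla^[k + 1] (q v) c := by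
  induction k generalizing c with
  | zero => simp [q₁]
  | succ k ih =>
    rw [nabla_iterate_succ, ih, ih, nabla_iterate_succ (q v) (k + 1),
      nabla_iterate_succ (q v) k c, nabla_iterate_succ (q v) k (c - 1)]
    push_cast
    ring

/-- This is the form in which `R'` arises below: the last term comes from shifting `s` to `s + 1` in
the gamma ratio. -/
lemma R'_eq (k : ℕ) (γ : ℝ) :
    R' u v k γ = 1 / (k.factorial : ℝ) * (nabla^[k] (p u) γ - nabla^[k] (q v) γ)
      - (γ - k) * (1 / ((k + 1).factorial : ℝ) * nabla^[k + 1] (q v) γ) := by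
  rw [R', nabla_iterate_q₁, Nat.factorial_succ]
  have := k.factorial_ne_zero
  push_cast
  field_simp
  ring

end Difference

/-- At `γ = n + δ - 1` the value is `-n`: this is the coefficient of `a n`, so the relation can be
solved for it when `n ≥ 1`. -/
lemma R'_pred {m : ℕ} (u v : Fin (m + 1) → ℝ) (γ : ℝ) :
    R' u v m γ = delta u v - 1 - γ := by
  rw [R'_eq, p_eq, q_eq, nabla_iterate_prod_succ, nabla_iterate_prod_succ, nabla_iterate_prod,
    delta, Finset.sum_sub_distrib, Finset.sum_sub_distrib, Finset.sum_sub_distrib]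
  have := m.factorial_ne_zero
  have := (m + 1).factorial_ne_zero
  field_simp
  simp
  ring

/-! ### The inverse factorial scale. -/

/-- The asymptotic scale `Γ (s + 1) / Γ (s + 1 + a)`, of order `s ^ (-a)` as `s → ∞`. -/
noncomputable def gammaRatio (a : ℝ) (s : ℕ) : ℝ := Real.Gamma (s + 1) / Real.Gamma (s + 1 + a)

lemma eventually_cast_add_pos (a : ℝ) : ∀ᶠ s : ℕ in atTop, 0 < (s : ℝ) + a := by
  filter_upwards [(tendsto_natCast_atTop_atTop (R := ℝ)).eventually_gt_atTop (-a)] with s hs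
  linarith

section GammaRatio

variable {a : ℝ} {s : ℕ}

lemma gammaRatio_pos (h : 0 < (s : ℝ) + 1 + a) : 0 < gammaRatio a s :=
  div_pos (Real.Gamma_pos_of_pos (by positivity)) (Real.Gamma_pos_of_pos h)

lemma mul_gammaRatio_add_one (h : 0 < (s : ℝ) + 1 + a) :
    (s + 1 + a) * gammaRatio (a + 1) s = gammaRatio a s := by
  have h1 := (Real.Gamma_pos_of_pos h).ne'
  rw [gammaRatio, gammaRatio, ← add_assoc, Real.Gamma_add_one h.ne']
  field_simp

lemma gammaRatio_succ (h : 0 < (s : ℝ) + 1 + a) :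
    gammaRatio a (s + 1) = gammaRatio a s - a * gammaRatio (a + 1) s := by
  have h1 := (Real.Gamma_pos_of_pos h).ne'
  have h2 : (s : ℝ) + 1 ≠ 0 := by positivity
  rw [← mul_gammaRatio_add_one h, ← sub_mul, add_sub_cancel_right, gammaRatio, gammaRatio,
    Nat.cast_succ, Real.Gamma_add_one h2, ← add_assoc]
  rw [show (s : ℝ) + 1 + 1 + a = s + 1 + a + 1 by ring]
  ring

/-- Falling factorials in `s + a` act on the scale as exact index shifts, which is why the
polynomial factors are expanded in the Newton basis. -/
lemma descPochhammer_mul_gammaRatio (k : ℕ) (h : 0 < (s : ℝ) + 1 + (a - k)) :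
    (descPochhammer ℝ k).eval (s + a) * gammaRatio a s = gammaRatio (a - k) s := by
  induction k with
  | zero => simp
  | succ k ih =>
    push_cast at h
    rw [descPochhammer_succ_eval, mul_right_comm, ih (by linarith), mul_comm, Nat.cast_succ,
      ← mul_gammaRatio_add_one (a := a - (k + 1)) h]
    congr 1
    · ring
    · ring_nf

end GammaRatio

lemma gammaRatio_add_one_isLittleO (a : ℝ) : gammaRatio (a + 1) =o[atTop] gammaRatio a := by
  have h : Tendsto (fun s : ℕ => ((s : ℝ) + (1 + a))⁻¹) atTop (𝓝 0) :=
    (tendsto_atTop_add_const_right _ _ tendsto_natCast_atTop_atTop).inv_tendsto_atTop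
  refine isLittleO_of_tendsto' ?_ (h.congr' ?_)
  · filter_upwards [eventually_cast_add_pos (1 + a)] with s hs h0
    exact absurd h0 (gammaRatio_pos (by linarith)).ne'
  · filter_upwards [eventually_cast_add_pos (1 + a)] with s hs
    rw [← add_assoc] at hs ⊢
    rw [← mul_gammaRatio_add_one hs, div_mul_cancel_right₀]
    exact (gammaRatio_pos (by linarith)).ne'

lemma gammaRatio_isBigO (a : ℝ) (k : ℕ) : gammaRatio (a + k) =O[atTop] gammaRatio a := by
  induction k with
  | zero => simpa using isBigO_refl _ _
  | succ k ih =>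
    rw [Nat.cast_succ, ← add_assoc]
    exact (gammaRatio_add_one_isLittleO _).isBigO.trans ih

lemma gammaRatio_isLittleO {a b : ℝ} {k : ℕ} (hk : 0 < k) (hb : b = a + k) :
    gammaRatio b =o[atTop] gammaRatio a := by
  obtain ⟨k, rfl⟩ := Nat.exists_eq_succ_of_ne_zero hk.ne'
  rw [hb, Nat.cast_succ, ← add_assoc]
  exact (gammaRatio_add_one_isLittleO _).trans_isBigO (gammaRatio_isBigO a k)

lemma gammaRatio_shift_isBigO (a : ℝ) : (fun s => gammaRatio a (s + 1)) =O[atTop] gammaRatio a := by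
  have h : (fun s => gammaRatio a s - a * gammaRatio (a + 1) s) =O[atTop] gammaRatio a :=
    (isBigO_refl _ _).sub ((gammaRatio_add_one_isLittleO a).isBigO.const_mul_left a)
  refine h.congr' ?_ .rfl
  filter_upwards [eventually_cast_add_pos (1 + a)] with s hs
  exact (gammaRatio_succ (by linarith)).symm

lemma linear_mul_gammaRatio_isBigO (u a : ℝ) :
    (fun s : ℕ => ((s : ℝ) + u) * gammaRatio a s) =O[atTop] gammaRatio (a - 1) := by
  have h1 := (gammaRatio_add_one_isLittleO (a - 1)).isBigO
  rw [sub_add_cancel] at h1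
  refine ((isBigO_refl (gammaRatio (a - 1)) atTop).add (h1.const_mul_left (u - a))).congr' ?_ .rfl
  filter_upwards [eventually_cast_add_pos a] with s hs
  have := mul_gammaRatio_add_one (a := a - 1) (s := s) (by linarith)
  rw [sub_add_cancel] at this
  rw [← this]
  ring

lemma prod_mul_isBigO {m : ℕ} (u : Fin m → ℝ) {F : ℕ → ℝ} {a : ℝ}
    (hF : F =O[atTop] gammaRatio a) :
    (fun s : ℕ => (∏ i, ((s : ℝ) + u i)) * F s) =O[atTop] gammaRatio (a - m) := by
  induction m with
  | zero => simpa using hF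
  | succ m ih =>
    have h1 := (isBigO_refl (fun s : ℕ => (s : ℝ) + u 0) atTop).mul (ih fun i => u i.succ)
    have h2 := h1.trans (linear_mul_gammaRatio_isBigO (u 0) (a - m))
    simp_rw [Fin.prod_univ_succ, mul_assoc]
    rwa [Nat.cast_succ, ← sub_sub]

/-- Consecutive values of `gammaRatio a` have ratio tending to `1`, so the quotients are summable by
the ratio test and tend to zero. -/
lemma half_pow_isBigO (a : ℝ) : (fun s : ℕ => (1 / 2 : ℝ) ^ s) =O[atTop] gammaRatio a := by
  have hne : ∀ᶠ s : ℕ in atTop, 0 < gammaRatio a s := by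
    filter_upwards [eventually_cast_add_pos (1 + a)] with s hs
    exact gammaRatio_pos (by linarith)
  have hlim : Tendsto (fun s => gammaRatio a (s + 1) / gammaRatio a s) atTop (𝓝 1) := by
    have h := ((gammaRatio_add_one_isLittleO a).tendsto_div_nhds_zero.const_mul a).const_sub 1
    rw [mul_zero, sub_zero] at h
    refine h.congr' ?_
    filter_upwards [eventually_cast_add_pos (1 + a), hne] with s hs hs'
    rw [gammaRatio_succ (by linarith), sub_div, div_self hs'.ne', mul_div_assoc]
  have hsum : Summable fun s : ℕ => (1 / 2 : ℝ) ^ s / gammaRatio a s := by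
    refine summable_of_ratio_test_tendsto_lt_one (l := 1 / 2) (by norm_num) ?_ ?_
    · filter_upwards [hne] with s hs
      exact (div_pos (by positivity) hs).ne'
    · have h := (hlim.inv₀ one_ne_zero).const_mul (1 / 2 : ℝ)
      rw [inv_one, mul_one] at h
      refine h.congr' ?_
      filter_upwards [hne, (tendsto_add_atTop_nat 1).eventually hne] with s h1 h2
      rw [Real.norm_of_nonneg (div_pos (by positivity) h1).le,
        Real.norm_of_nonneg (div_pos (by positivity) h2).le, pow_succ]
      field_simp
  refine (isLittleO_of_tendsto' ?_ hsum.tendsto_atTop_zero).isBigO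
  filter_upwards [hne] with s hs h0
  exact absurd h0 hs.ne'

/-! ### Asymptotic expansion of the moments. -/

lemma integral_pow_mul_betaKernel_one {b : ℝ} (hb : 0 < b) (s : ℕ) :
    ∫ x, x ^ s * betaKernel 1 b x = Real.Gamma b * gammaRatio b s := by
  simp_rw [pow_mul_betaKernel]
  rw [integral_betaKernel (by positivity) hb, beta, gammaRatio, add_comm (1 : ℝ)]
  ring

lemma betaKernel_one_of_mem {b x : ℝ} (hx : x ∈ Ioo (0 : ℝ) 1) :
    betaKernel 1 b x = (1 - x) ^ (b - 1) := by
  rw [betaKernel_of_mem hx, sub_self, Real.rpow_zero, one_mul]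

namespace IsRep

variable {M : ℕ → ℝ} {δ : ℝ} {a : ℕ → ℝ} {f : ℝ → ℝ}

lemma abs_sub_sum_le (h : IsRep M δ a f) (N : ℕ) {x : ℝ} (hx : x ∈ Ico (1 / 2 : ℝ) 1) :
    |f x - ∑ n ∈ Finset.range N, a n * BetaProduct.betaKernel 1 (δ + n) x|
      ≤ (∑' k, |a (k + N)| * (1 / 2) ^ k) * BetaProduct.betaKernel 1 (δ + N) x := by
  have hx' : x ∈ Ioo (0 : ℝ) 1 := ⟨by linarith [hx.1], hx.2⟩
  have hw : 0 < 1 - x := by linarith [hx.2]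
  have hpow (n : ℕ) : (1 - x) ^ (δ + n - 1) = (1 - x) ^ (δ - 1) * (1 - x) ^ n := by
    rw [← Real.rpow_natCast, ← Real.rpow_add hw]
    congr 1
    ring
  have hs : Summable fun k => a k * (1 - x) ^ k := by
    refine Summable.of_norm ?_
    simpa only [norm_mul, norm_pow, Real.norm_eq_abs, abs_of_pos hw] using
      h.summable (1 - x) ⟨hw.le, by linarith [hx.1]⟩
  have hs2 : Summable fun k => |a (k + N)| * (1 / 2) ^ k := by
    have h2 := (summable_nat_add_iff N).2 (h.summable (1 / 2) (by norm_num))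
    refine (h2.mul_left (2 ^ N)).congr fun k => ?_
    rw [pow_add, mul_comm, mul_assoc, mul_assoc, ← mul_pow]
    norm_num
  have e : f x - ∑ n ∈ Finset.range N, a n * BetaProduct.betaKernel 1 (δ + n) x
      = (∑' k, a (k + N) * (1 - x) ^ k) * BetaProduct.betaKernel 1 (δ + N) x := by
    have e1 : ∑ n ∈ Finset.range N, a n * BetaProduct.betaKernel 1 (δ + n) x
        = (1 - x) ^ (δ - 1) * ∑ n ∈ Finset.range N, a n * (1 - x) ^ n := by
      rw [Finset.mul_sum]
      refine Finset.sum_congr rfl fun n _ => ?_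
      rw [betaKernel_one_of_mem hx', hpow]
      ring
    rw [e1, h.eq_tsum x hx', ← hs.sum_add_tsum_nat_add N, betaKernel_one_of_mem hx', hpow]
    simp_rw [pow_add, ← mul_assoc, tsum_mul_right]
    ring
  rw [e, abs_mul, abs_of_nonneg (betaKernel_nonneg _ _ _)]
  refine mul_le_mul_of_nonneg_right ?_ (betaKernel_nonneg _ _ _)
  rw [← Real.norm_eq_abs]
  refine tsum_of_norm_bounded hs2.hasSum fun k => ?_
  rw [norm_mul, norm_pow, Real.norm_of_nonneg hw.le, Real.norm_eq_abs]
  gcongr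
  linarith [hx.1]

/-- The moments have an asymptotic inverse factorial expansion. -/
lemma moment_sub_sum_isBigO (h : IsRep M δ a f) (hδ : 0 < δ) (N : ℕ) :
    (fun s => M s - ∑ n ∈ Finset.range N, a n * Real.Gamma (δ + n) * gammaRatio (δ + n) s)
      =O[atTop] gammaRatio (δ + N) := by
  set K := ∑' k, |a (k + N)| * (1 / 2 : ℝ) ^ k with hK
  have hK0 : 0 ≤ K := tsum_nonneg fun k => by positivity
  set r : ℝ → ℝ := fun x => f x - ∑ n ∈ Finset.range N, a n * BetaProduct.betaKernel 1 (δ + n) x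
    with hr
  have hbk (n : ℕ) : Integrable (BetaProduct.betaKernel 1 (δ + n)) :=
    integrable_betaKernel one_pos (by positivity)
  have hb0 (b : ℝ) : ∀ x ∉ Ioo (0 : ℝ) 1, BetaProduct.betaKernel 1 b x = 0 :=
    fun x hx => betaKernel_of_notMem hx
  have hri : Integrable r :=
    h.integrable.sub (integrable_finsetSum _ fun n _ => (hbk n).const_mul _)
  have hr0 : ∀ x ∉ Ioo (0 : ℝ) 1, r x = 0 := fun x hx => by
    simp [hr, h.eq_zero x hx, hb0 _ x hx]
  have hint (s : ℕ) : M s - ∑ n ∈ Finset.range N, a n * Real.Gamma (δ + n) * gammaRatio (δ + n) s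
      = ∫ x, x ^ s * r x := by
    simp_rw [hr, mul_sub, Finset.mul_sum, mul_left_comm _ (a _)]
    rw [integral_sub (integrable_pow_mul h.integrable h.eq_zero s)
      (integrable_finsetSum _ fun n _ => (integrable_pow_mul (hbk n) (hb0 _) s).const_mul _),
      integral_finsetSum _ fun n _ => (integrable_pow_mul (hbk n) (hb0 _) s).const_mul _, h.moment]
    congr 1
    refine Finset.sum_congr rfl fun n _ => ?_
    rw [integral_const_mul, integral_pow_mul_betaKernel_one (by positivity), mul_assoc]
  have hbound (s : ℕ) : ‖∫ x, x ^ s * r x‖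
      ≤ K * Real.Gamma (δ + N) * gammaRatio (δ + N) s + (∫ x, |r x|) * (1 / 2) ^ s := by
    have hi1 := (integrable_pow_mul (hbk N) (hb0 _) s).const_mul K
    have hi2 := hri.abs.mul_const ((1 / 2 : ℝ) ^ s)
    rw [mul_assoc, ← integral_pow_mul_betaKernel_one (by positivity), ← integral_const_mul,
      ← integral_mul_const, ← integral_add hi1 hi2]
    refine norm_integral_le_of_norm_le (hi1.add hi2) (ae_of_all _ fun x => ?_)
    by_cases hx : x ∈ Ioo (0 : ℝ) 1
    · rw [norm_mul, norm_pow, Real.norm_of_nonneg hx.1.le, Real.norm_eq_abs]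
      have hx0 := hx.1.le
      have hβ := betaKernel_nonneg 1 (δ + N) x
      -- On `[1/2, 1)` the series remainder is controlled by one beta kernel. On `(0, 1/2]`, where
      -- the series need not be controlled, `x ^ s ≤ (1/2) ^ s` is negligible against the whole
      -- scale.
      rcases le_total (1 / 2) x with hx2 | hx2
      · have h1 := mul_le_mul_of_nonneg_left (h.abs_sub_sum_le N ⟨hx2, hx.2⟩) (pow_nonneg hx0 s)
        have h2 : 0 ≤ |r x| * (1 / 2) ^ s := by positivity
        change x ^ s * |r x| ≤ x ^ s * (K * _) at h1
        linarith
      · have h1 := mul_le_mul_of_nonneg_right (pow_le_pow_left₀ hx0 hx2 s) (abs_nonneg (r x))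
        have h2 : 0 ≤ K * (x ^ s * BetaProduct.betaKernel 1 (δ + N) x) := by positivity
        linarith
    · simp [hr0 x hx, hb0 _ x hx]
  simp_rw [hint]
  refine IsBigO.trans (.of_norm_le hbound) ?_
  exact ((isBigO_refl _ _).const_mul_left _).add ((half_pow_isBigO _).const_mul_left _)

end IsRep

/-! ### Uniqueness of asymptotic coefficients. -/

lemma coeff_eq_zero_of_isLittleO {D : ℕ → ℝ} {β : ℝ}
    (h : ∀ J : ℕ, (fun s => ∑ j ∈ Finset.range (J + 1), D j * gammaRatio (β + j) s)
      =o[atTop] gammaRatio (β + J)) (J : ℕ) : D J = 0 := by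
  induction J using Nat.strong_induction_on with
  | _ J ih =>
    have h1 : (fun s => D J * gammaRatio (β + J) s) =o[atTop] gammaRatio (β + J) := by
      refine (h J).congr_left fun s => ?_
      rw [Finset.sum_range_succ, Finset.sum_eq_zero fun j hj => ?_, zero_add]
      rw [ih j (Finset.mem_range.1 hj), zero_mul]
    by_contra hD
    have h2 := (isLittleO_const_mul_left_iff hD).1 h1
    have hne : ∀ᶠ s : ℕ in atTop, gammaRatio (β + J) s ≠ 0 := by
      filter_upwards [eventually_cast_add_pos (1 + (β + J))] with s hs
      exact (gammaRatio_pos (by linarith)).ne'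
    exact isLittleO_irrefl hne.frequently h2

lemma sum_antidiagonal_eq_zero_of_isBigO {c : ℕ → ℕ → ℝ} {β : ℝ} {L : ℕ}
    (hc : ∀ l n, L ≤ l → c l n = 0)
    (h : ∀ N : ℕ, (fun s => ∑ n ∈ Finset.range N, ∑ l ∈ Finset.range L,
      c l n * gammaRatio (β + (n + l : ℕ)) s) =O[atTop] gammaRatio (β + N - 1)) (J : ℕ) :
    ∑ x ∈ Finset.HasAntidiagonal.antidiagonal J, c x.1 x.2 = 0 := by
  refine coeff_eq_zero_of_isLittleO (β := β)
    (D := fun J => ∑ x ∈ Finset.HasAntidiagonal.antidiagonal J, c x.1 x.2) (fun J => ?_) J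
  -- The rectangle contains every pair with `l + n ≤ J`. Its extra rows `l ≥ L` contribute nothing
  -- by `hc`, and `J + 2` columns are taken because the error in `h` loses one order.
  set X := Finset.range (L + (J + 1)) ×ˢ Finset.range (J + 2) with hX
  set F : ℕ → ℕ × ℕ → ℝ := fun s x => c x.1 x.2 * gammaRatio (β + (x.2 + x.1 : ℕ)) s with hF
  have hlow (s : ℕ) : ∑ x ∈ X with x.1 + x.2 ≤ J, F s x = ∑ j ∈ Finset.range (J + 1),
      (∑ x ∈ Finset.HasAntidiagonal.antidiagonal j, c x.1 x.2) * gammaRatio (β + j) s := by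
    rw [← Finset.sum_fiberwise_of_maps_to (t := Finset.range (J + 1)) (g := fun x => x.1 + x.2)
      fun x hx => by
        have := (Finset.mem_filter.1 hx).2
        exact Finset.mem_range.2 (by lia)]
    refine Finset.sum_congr rfl fun j hj => ?_
    rw [Finset.sum_mul]
    have hj' := Finset.mem_range.1 hj
    refine Finset.sum_congr ?_ fun x hx => ?_
    · ext x
      simp only [hX, Finset.mem_filter, Finset.mem_product, Finset.mem_range,
        Finset.HasAntidiagonal.mem_antidiagonal]
      lia
    · rw [hF, ← Finset.HasAntidiagonal.mem_antidiagonal.1 hx, add_comm x.1]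
  have hhigh : (fun s => ∑ x ∈ X with ¬ x.1 + x.2 ≤ J, F s x) =o[atTop] gammaRatio (β + J) := by
    refine .fun_sum fun x hx => ?_
    have hx' := (Finset.mem_filter.1 hx).2
    refine (gammaRatio_isLittleO (k := x.1 + x.2 - J) (by lia) ?_).const_mul_left _
    rw [add_assoc, ← Nat.cast_add]
    congr 2
    lia
  have htot : (fun s => ∑ x ∈ X, F s x) =o[atTop] gammaRatio (β + J) := by
    refine ((h (J + 2)).trans_isLittleO (gammaRatio_isLittleO (a := β + J) one_pos ?_)).congr_left
      fun s => ?_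
    · push_cast
      ring
    · rw [hX, Finset.sum_product_right]
      refine Finset.sum_congr rfl fun n _ => ?_
      refine Finset.sum_subset (Finset.range_subset_range.2 (by lia)) fun l _ hl => ?_
      rw [hc l n (by simpa using hl), zero_mul]
  refine (htot.sub hhigh).congr_left fun s => ?_
  rw [← hlow, ← Finset.sum_filter_add_sum_filter_not X (fun x => x.1 + x.2 ≤ J),
    add_sub_cancel_right]

/-! ### From the functional equation of the moments to the recurrence. -/

section Recurrence

variable {μ : ℕ} (u v : Fin (μ + 1) → ℝ)

/-- The coefficient of `gammaRatio (a - μ + l)` in the expansion of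
`∏ (s + u i) * gammaRatio a s - ∏ (s + v i) * gammaRatio a (s + 1)`, up to sign. -/
noncomputable def transferCoeff (l : ℕ) (a : ℝ) : ℝ :=
  if l ≤ μ then (-1) ^ (μ - l) * R' u v (μ - l) (a - 1)
  else if l = μ + 1 then a * q v (a - 1) else 0

/-- Newton's formula at `γ = a - 1`, `y = s + a`, where each factor `γ - y + 1 - u i` equals `-(s +
u i)`. -/
lemma prod_mul_gammaRatio {a : ℝ} {s : ℕ} (hs : 0 < (s : ℝ) + (a - μ)) :
    (-1) ^ (μ + 1) * ((∏ i, ((s : ℝ) + u i)) * gammaRatio a s)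
      = ∑ k ∈ Finset.range (μ + 2),
        (-1) ^ k / (k.factorial : ℝ) * nabla^[k] (p u) (a - 1) * gammaRatio (a - k) s := by
  have h := prod_sub_eq_sum_nabla (fun i => 1 - u i) (a - 1) (s + a)
  rw [← p_eq] at h
  have e : ∏ i, (a - 1 - (s + a) + (1 - u i)) = (-1) ^ (μ + 1) * ∏ i, ((s : ℝ) + u i) := by
    rw [← Fin.prod_const, ← Finset.prod_mul_distrib]
    refine Finset.prod_congr rfl fun i _ => ?_
    ring
  rw [← mul_assoc, ← e, h, Finset.sum_mul]
  refine Finset.sum_congr rfl fun k hk => ?_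
  have hk' : (k : ℝ) ≤ μ + 1 := by exact_mod_cast Nat.lt_succ_iff.1 (Finset.mem_range.1 hk)
  rw [mul_assoc, descPochhammer_mul_gammaRatio k (by linarith)]

lemma prod_mul_gammaRatio_succ {a : ℝ} {s : ℕ} (hs : 0 < (s : ℝ) + (a - μ)) :
    (-1) ^ (μ + 1) * ((∏ i, ((s : ℝ) + v i)) * gammaRatio a (s + 1))
      = ∑ k ∈ Finset.range (μ + 2), (-1) ^ k / (k.factorial : ℝ) * nabla^[k] (q v) (a - 1)
          * (gammaRatio (a - k) s - (a - k) * gammaRatio (a - k + 1) s) := by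
  have h := prod_sub_eq_sum_nabla (fun i => 2 - v i) (a - 1) ((s + 1 : ℕ) + a)
  rw [← q_eq] at h
  have e : ∏ i, (a - 1 - ((s + 1 : ℕ) + a) + (2 - v i))
      = (-1) ^ (μ + 1) * ∏ i, ((s : ℝ) + v i) := by
    rw [← Fin.prod_const, ← Finset.prod_mul_distrib]
    refine Finset.prod_congr rfl fun i _ => ?_
    push_cast
    ring
  rw [← mul_assoc, ← e, h, Finset.sum_mul]
  refine Finset.sum_congr rfl fun k hk => ?_
  have hk' : (k : ℝ) ≤ μ + 1 := by exact_mod_cast Nat.lt_succ_iff.1 (Finset.mem_range.1 hk)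
  rw [mul_assoc, descPochhammer_mul_gammaRatio k (by push_cast; linarith),
    gammaRatio_succ (by linarith)]

lemma prod_mul_gammaRatio_sub {a : ℝ} {s : ℕ} (hs : 0 < (s : ℝ) + (a - μ)) :
    (∏ i, ((s : ℝ) + u i)) * gammaRatio a s - (∏ i, ((s : ℝ) + v i)) * gammaRatio a (s + 1)
      = (-1) ^ (μ + 1) * ∑ l ∈ Finset.range (μ + 2),
          transferCoeff u v l a * gammaRatio (a - μ + l) s := by
  have hsq : ((-1 : ℝ) ^ (μ + 1)) * (-1) ^ (μ + 1) = 1 := by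
    rw [← mul_pow]; simp
  suffices h : (-1) ^ (μ + 1) * ((∏ i, ((s : ℝ) + u i)) * gammaRatio a s)
      - (-1) ^ (μ + 1) * ((∏ i, ((s : ℝ) + v i)) * gammaRatio a (s + 1))
      = ∑ l ∈ Finset.range (μ + 2), transferCoeff u v l a * gammaRatio (a - μ + l) s by
    rw [← h, ← mul_sub, ← mul_assoc, hsq, one_mul]
  have hrhs : ∑ l ∈ Finset.range (μ + 2), transferCoeff u v l a * gammaRatio (a - μ + l) s
      = (∑ k ∈ Finset.range (μ + 1), (-1) ^ k * R' u v k (a - 1) * gammaRatio (a - k) s)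
        + a * q v (a - 1) * gammaRatio (a + 1) s := by
    rw [Finset.sum_range_succ, ← Finset.sum_range_reflect]
    congr 1
    · refine Finset.sum_congr rfl fun l hl => ?_
      have hl' := Nat.lt_succ_iff.1 (Finset.mem_range.1 hl)
      rw [show μ + 1 - 1 - l = μ - l by lia, transferCoeff, if_pos (Nat.sub_le _ _),
        Nat.sub_sub_self hl', Nat.cast_sub hl']
      congr 2
      ring
    · rw [transferCoeff, if_neg (by lia), if_pos rfl]
      congr 2
      push_cast
      ring
  rw [prod_mul_gammaRatio u hs, prod_mul_gammaRatio_succ v hs, hrhs]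
  simp_rw [mul_sub]
  rw [Finset.sum_sub_distrib, ← sub_add, ← Finset.sum_sub_distrib, Finset.sum_range_succ,
    Finset.sum_range_succ' _ (μ + 1)]
  -- Both polynomials are monic of degree `μ + 1`, so the leading terms cancel and the expansion
  -- starts at index `a - μ`.
  have htop : nabla^[μ + 1] (p u) (a - 1) = nabla^[μ + 1] (q v) (a - 1) := by
    rw [p_eq, q_eq, nabla_iterate_prod, nabla_iterate_prod]
  rw [htop, sub_self, add_zero, ← add_assoc, ← Finset.sum_add_distrib]
  congr 1
  · refine Finset.sum_congr rfl fun k _ => ?_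
    rw [R'_eq, show a - (k + 1 : ℕ) + 1 = a - k by push_cast; ring]
    push_cast
    ring
  · simp
    ring

/-- Inserting the truncated expansion into `hM` leaves a remainder of index `δ + N - (μ + 1)`, since
the products have degree `μ + 1`; uniqueness of coefficients then applies. -/
lemma sum_transferCoeff_eq_zero {M e : ℕ → ℝ} {δ : ℝ}
    (hM : ∀ s : ℕ, (∏ i, ((s : ℝ) + u i)) * M s = (∏ i, ((s : ℝ) + v i)) * M (s + 1))
    (he : ∀ N : ℕ, (fun s => M s - ∑ n ∈ Finset.range N, e n * gammaRatio (δ + n) s)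
      =O[atTop] gammaRatio (δ + N)) (J : ℕ) :
    ∑ x ∈ Finset.HasAntidiagonal.antidiagonal J,
      transferCoeff u v x.1 (δ + x.2) * e x.2 = 0 := by
  refine sum_antidiagonal_eq_zero_of_isBigO (β := δ - μ) (L := μ + 2)
    (c := fun l n => transferCoeff u v l (δ + n) * e n) (fun l n hl => ?_) (fun N => ?_) J
  · rw [transferCoeff, if_neg (by lia), if_neg (by lia), zero_mul]
  have h1 := prod_mul_isBigO u (he N)
  have h2 := prod_mul_isBigO v
    (((he N).comp_tendsto (tendsto_add_atTop_nat 1)).trans (gammaRatio_shift_isBigO _))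
  have h3 := (h2.sub h1).const_mul_left ((-1) ^ (μ + 1))
  rw [show δ + N - (μ + 1 : ℕ) = δ - μ + N - 1 by push_cast; ring] at h3
  refine h3.congr' ?_ .rfl
  have hev : ∀ᶠ s : ℕ in atTop, ∀ n ∈ Finset.range N, 0 < (s : ℝ) + (δ + n - μ) :=
    (Finset.eventually_all _).2 fun n _ => eventually_cast_add_pos _
  filter_upwards [hev] with s hs
  have hsq : ((-1 : ℝ) ^ (μ + 1)) * (-1) ^ (μ + 1) = 1 := by
    rw [← mul_pow]; simp
  have e1 (n : ℕ) (hn : n ∈ Finset.range N) : ∑ l ∈ Finset.range (μ + 2),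
      transferCoeff u v l (δ + n) * e n * gammaRatio (δ - μ + (n + l : ℕ)) s
      = (-1) ^ (μ + 1) * (e n * ((∏ i, ((s : ℝ) + u i)) * gammaRatio (δ + n) s
        - (∏ i, ((s : ℝ) + v i)) * gammaRatio (δ + n) (s + 1))) := by
    rw [prod_mul_gammaRatio_sub u v (hs n hn), mul_left_comm (e n), ← mul_assoc, hsq, one_mul,
      Finset.mul_sum]
    refine Finset.sum_congr rfl fun l _ => ?_
    rw [show δ - μ + (n + l : ℕ) = δ + n - μ + l by push_cast; ring]
    ring
  rw [Finset.sum_congr rfl e1, ← Finset.mul_sum]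
  congr 1
  simp only [Function.comp_apply, mul_sub, hM, Finset.sum_sub_distrib, Finset.mul_sum,
    mul_left_comm (e _)]
  ring

end Recurrence

lemma Gamma_eq_poch_mul {x : ℝ} {k : ℕ} (h : (k : ℝ) < x) :
    Real.Gamma x = (-1) ^ k * poch (-x + 1) k * Real.Gamma (x - k) := by
  induction k with
  | zero => simp [poch]
  | succ k ih =>
    push_cast at h
    have h1 : x - k = x - (k + 1) + 1 := by ring
    rw [ih (by linarith), poch_succ, h1, Real.Gamma_add_one (by linarith), Nat.cast_succ]
    ring

lemma sum_Icc_truncate {t : ℕ → ℝ} {μ n : ℕ} (ht : ∀ l, μ + 1 < l → t l = 0) :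
    ∑ l ∈ Finset.Icc 1 n, t l
      = (∑ l ∈ Finset.Icc 1 (min μ n), t l) + if μ + 1 ≤ n then t (μ + 1) else 0 := by
  split_ifs with h
  · rw [min_eq_left (by lia), ← Finset.sum_Icc_succ_top (by lia)]
    refine (Finset.sum_subset (Finset.Icc_subset_Icc_right h) fun l hl hl' => ht l ?_).symm
    simp only [Finset.mem_Icc] at hl hl'
    lia
  · rw [min_eq_right (by lia), add_zero]

lemma transferCoeff_mul_Gamma {μ : ℕ} (u v : Fin (μ + 1) → ℝ) {δ : ℝ} (hδ : 0 < δ) {n l : ℕ}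
    (hl : l ≤ n) :
    transferCoeff u v l (δ + (n - l : ℕ)) * Real.Gamma (δ + (n - l : ℕ))
      = (-1) ^ μ * Real.Gamma (δ + n) *
        (if l ≤ μ then 1 / poch (-n - δ + 1) l * R' u v (μ - l) (n - l + δ - 1)
          else if l = μ + 1 then 1 / poch (-n - δ + 1) μ * q v (n - l + δ - 1) else 0) := by
  have hΓ (k : ℕ) (hk : k ≤ n) :
      Real.Gamma (δ + (n - k : ℕ)) = (-1) ^ k * Real.Gamma (δ + n) / poch (-n - δ + 1) k := by
    have hk' : (k : ℝ) ≤ n := by exact_mod_cast hk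
    have h1 := Gamma_eq_poch_mul (x := δ + n) (k := k) (by linarith)
    have h2 := (Real.Gamma_pos_of_pos (by positivity : 0 < δ + n)).ne'
    rw [show -(δ + n) + 1 = -n - δ + 1 by ring] at h1
    have h3 : poch (-n - δ + 1) k ≠ 0 := fun h0 => h2 (by rw [h1, h0]; ring)
    rw [eq_div_iff h3, h1, Nat.cast_sub hk, add_sub_assoc]
    have : ((-1 : ℝ) ^ k) * (-1) ^ k = 1 := by rw [← mul_pow]; simp
    linear_combination (-(Real.Gamma (δ + (n - k)) * poch (-n - δ + 1) k)) * this
  have harg : δ + (n - l : ℕ) - 1 = n - l + δ - 1 := by rw [Nat.cast_sub hl]; ring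
  rw [transferCoeff, harg]
  split_ifs with h1 h2
  · rw [hΓ l hl]
    have : (-1 : ℝ) ^ (μ - l) * (-1) ^ l = (-1) ^ μ := by rw [← pow_add, Nat.sub_add_cancel h1]
    rw [← this]
    ring
  · subst h2
    -- The factor `δ + (n - (μ + 1))` of `transferCoeff` raises the gamma argument by one, which is
    -- why the Pochhammer index is `μ` and not `μ + 1`.
    have h3 := hΓ μ (by lia)
    rw [show n - μ = n - (μ + 1) + 1 by lia, Nat.cast_succ, ← add_assoc,
      Real.Gamma_add_one (by positivity)] at h3
    rw [mul_right_comm, h3]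
    ring
  · simp

namespace IsRep

variable {μ : ℕ} {u v : Fin (μ + 1) → ℝ} {a : ℕ → ℝ} {f : ℝ → ℝ}

lemma recurrence (huv : ∀ i, 0 < u i ∧ u i < v i)
    (h : IsRep (fun n => ∏ i, poch (u i) n / poch (v i) n) (delta u v) a f) (n : ℕ) :
    n * a n = ∑ l ∈ Finset.Icc 1 n,
      (if l ≤ μ then 1 / poch (-n - delta u v + 1) l * R' u v (μ - l) (n - l + delta u v - 1)
        else if l = μ + 1 then
          1 / poch (-n - delta u v + 1) μ * q v (n - l + delta u v - 1) else 0) * a (n - l) := by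
  have hδ := delta_pos huv
  have hfun (s : ℕ) : (∏ i, ((s : ℝ) + u i)) * ∏ i, poch (u i) s / poch (v i) s
      = (∏ i, ((s : ℝ) + v i)) * ∏ i, poch (u i) (s + 1) / poch (v i) (s + 1) := by
    rw [← Finset.prod_mul_distrib, ← Finset.prod_mul_distrib]
    refine Finset.prod_congr rfl fun i _ => ?_
    have hv : 0 < v i := (huv i).1.trans (huv i).2
    have h1 := (poch_pos hv s).ne'
    have h2 : v i + s ≠ 0 := by positivity
    rw [poch_succ, poch_succ]
    field_simp
    ring
  have h0 := sum_transferCoeff_eq_zero u v (δ := delta u v)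
    (M := fun n => ∏ i, poch (u i) n / poch (v i) n)
    (e := fun n => a n * Real.Gamma (delta u v + n)) hfun (h.moment_sub_sum_isBigO hδ) n
  have hconv := Finset.Nat.sum_antidiagonal_eq_sum_range_succ_mk
    (fun x : ℕ × ℕ => transferCoeff u v x.1 (delta u v + x.2) *
      (a x.2 * Real.Gamma (delta u v + x.2))) n
  rw [hconv] at h0
  have hterm (l : ℕ) (hl : l ∈ Finset.range n.succ) :
      transferCoeff u v l (delta u v + (n - l : ℕ)) *
        (a (n - l) * Real.Gamma (delta u v + (n - l : ℕ)))
      = (-1) ^ μ * Real.Gamma (delta u v + n) *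
      ((if l ≤ μ then 1 / poch (-n - delta u v + 1) l * R' u v (μ - l) (n - l + delta u v - 1)
        else if l = μ + 1 then
          1 / poch (-n - delta u v + 1) μ * q v (n - l + delta u v - 1) else 0) * a (n - l)) := by
    rw [← mul_assoc, mul_right_comm,
      transferCoeff_mul_Gamma u v hδ (Nat.lt_succ_iff.1 (Finset.mem_range.1 hl)), mul_assoc]
  have hne : (-1) ^ μ * Real.Gamma (delta u v + n) ≠ 0 :=
    mul_ne_zero (by simp) (Real.Gamma_pos_of_pos (by positivity)).ne'
  rw [Finset.sum_congr rfl hterm, ← Finset.mul_sum, mul_eq_zero, or_iff_right hne,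
    Finset.range_eq_Ico, Finset.sum_eq_sum_Ico_succ_bot n.succ_pos, if_pos μ.zero_le,
    Nat.sub_zero, R'_pred] at h0
  simp only [poch, ascPochhammer_zero, Polynomial.eval_one, Nat.cast_zero, Nat.sub_zero] at h0
  change _ + ∑ l ∈ Finset.Icc 1 n, _ = 0 at h0
  simp only [poch]
  linarith

lemma isCoeffSeq (huv : ∀ i, 0 < u i ∧ u i < v i)
    (h : IsRep (fun n => ∏ i, poch (u i) n / poch (v i) n) (delta u v) a f) (ha : a 0 ≠ 0) :
    IsCoeffSeq u v fun n => a n / a 0 := by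
  refine ⟨div_self ha, fun n hn => ?_⟩
  have hn' : (n : ℝ) ≠ 0 := by positivity
  have hrec := h.recurrence huv n
  rw [sum_Icc_truncate (μ := μ) fun l hl => by rw [if_neg (by lia), if_neg (by lia), zero_mul],
    if_neg (show ¬ μ + 1 ≤ μ by lia), if_pos rfl] at hrec
  rw [← mul_right_inj' (mul_ne_zero hn' ha), mul_assoc (n : ℝ), mul_div_cancel₀ _ ha, hrec,
    Nat.add_sub_cancel, mul_add, ← mul_assoc,
    show (n : ℝ) * a 0 * (1 / n) = a 0 by field_simp, Finset.mul_sum]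
  congr 1
  · refine Finset.sum_congr rfl fun l hl => ?_
    rw [if_pos ((Finset.mem_Icc.1 hl).2.trans (min_le_left _ _)), mul_left_comm,
      mul_div_cancel₀ _ ha]
  · split_ifs
    · field_simp
    · simp

end IsRep

/-! ### Uniqueness of the density. -/

/-- An integrable function on `[0, 1]` is determined almost
everywhere by its moments. -/
lemma ae_eq_zero_of_moments {h : ℝ → ℝ} (hh : IntegrableOn h (Icc (0 : ℝ) 1))
    (hm : ∀ n : ℕ, ∫ x in Icc (0 : ℝ) 1, x ^ n * h x = 0) :
    h =ᵐ[volume.restrict (Icc (0 : ℝ) 1)] 0 := by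
  have hpow (n : ℕ) : IntegrableOn (fun x => x ^ n * h x) (Icc (0 : ℝ) 1) :=
    hh.continuousOn_mul (continuous_pow n).continuousOn isCompact_Icc
  have hpoly (P : Polynomial ℝ) : ∫ x in Icc (0 : ℝ) 1, P.eval x * h x = 0 := by
    simp_rw [Polynomial.eval_eq_sum_range, Finset.sum_mul, mul_assoc]
    rw [integral_finsetSum _ fun n _ => (hpow n).const_mul _]
    simp_rw [integral_const_mul, hm, mul_zero, Finset.sum_const_zero]
  refine ae_eq_zero_of_integral_contDiff_smul_eq_zero hh.integrable.locallyIntegrable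
    fun g hg _ => ?_
  have hgh : IntegrableOn (fun x => g x * h x) (Icc (0 : ℝ) 1) :=
    hh.continuousOn_mul hg.continuous.continuousOn isCompact_Icc
  simp only [smul_eq_mul]
  refine norm_le_zero_iff.1 (le_of_forall_pos_le_add fun ε hε => ?_)
  set C := ∫ x in Icc (0 : ℝ) 1, |h x| with hC
  have hC0 : 0 ≤ C := integral_nonneg fun x => abs_nonneg _
  -- Weierstrass approximation; the `+ 1` guards against `C = 0`.
  obtain ⟨P, hP⟩ := exists_polynomial_near_of_continuousOn 0 1 g hg.continuous.continuousOn
    (ε / (C + 1)) (by positivity)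
  have hPh : IntegrableOn (fun x => P.eval x * h x) (Icc (0 : ℝ) 1) :=
    hh.continuousOn_mul P.continuous.continuousOn isCompact_Icc
  have e : ∫ x in Icc (0 : ℝ) 1, g x * h x = ∫ x in Icc (0 : ℝ) 1, (g x - P.eval x) * h x := by
    simp_rw [sub_mul]
    rw [integral_sub hgh hPh, hpoly, sub_zero]
  rw [e, zero_add]
  calc ‖∫ x in Icc (0 : ℝ) 1, (g x - P.eval x) * h x‖
      ≤ ∫ x in Icc (0 : ℝ) 1, ε / (C + 1) * |h x| := by
        refine norm_integral_le_of_norm_le (hh.abs.const_mul _) ?_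
        filter_upwards [ae_restrict_mem measurableSet_Icc] with x hx
        rw [norm_mul, Real.norm_eq_abs, Real.norm_eq_abs, abs_sub_comm]
        exact mul_le_mul_of_nonneg_right (hP x hx).le (abs_nonneg _)
    _ = ε / (C + 1) * C := integral_const_mul _ _
    _ ≤ ε := by
        rw [div_mul_eq_mul_div, div_le_iff₀ (by positivity)]
        nlinarith

lemma ae_eq_of_hasMoments {m : ℕ} {u v : Fin m → ℝ} {f g : ℝ → ℝ} (hf : IsDensity f)
    (hfm : HasMoments u v f) (hg : IsDensity g) (hgm : HasMoments u v g) :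
    g =ᵐ[volume.restrict (Icc (0 : ℝ) 1)] f := by
  have hpow {k : ℝ → ℝ} (hk : IntegrableOn k (Icc (0 : ℝ) 1)) (n : ℕ) :
      IntegrableOn (fun x => x ^ n * k x) (Icc (0 : ℝ) 1) :=
    hk.continuousOn_mul (continuous_pow n).continuousOn isCompact_Icc
  have h := ae_eq_zero_of_moments (hg.2.1.sub hf.2.1) fun n => by
    have h1 := hfm n
    have h2 := hgm n
    rw [intervalIntegral.integral_of_le zero_le_one, ← integral_Icc_eq_integral_Ioc] at h1 h2
    simp_rw [Pi.sub_apply, mul_sub]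
    rw [integral_sub (hpow hg.2.1 n) (hpow hf.2.1 n), h1, h2, sub_self]
  filter_upwards [h] with x hx
  exact sub_eq_zero.1 hx

end BetaProduct

/-! ### Assembly. -/

theorem theorem1 (m : ℕ) (hm : 1 ≤ m) (u v : Fin m → ℝ)
    (huv : ∀ i, 0 < u i ∧ u i < v i) :
    ∃ c : ℕ → ℝ, BetaProduct.IsCoeffSeq u v c ∧
      (∀ x ∈ Set.Ioc (0 : ℝ) 1, Summable fun n : ℕ => c (n + 1) * (1 - x) ^ (n + 1)) ∧
      ∃ f : ℝ → ℝ, BetaProduct.IsDensity f ∧ BetaProduct.HasMoments u v f ∧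
        (∀ x ∈ Set.Ioc (0 : ℝ) 1, (x = 1 → 1 ≤ BetaProduct.delta u v) →
          f x = 1 / Real.Gamma (BetaProduct.delta u v)
            * (∏ i, Real.Gamma (v i) / Real.Gamma (u i))
            * (1 - x) ^ (BetaProduct.delta u v - 1)
            * (1 + ∑' n : ℕ, c (n + 1) * (1 - x) ^ (n + 1))) ∧
        ∀ g : ℝ → ℝ, BetaProduct.IsDensity g → BetaProduct.HasMoments u v g →
          g =ᵐ[MeasureTheory.volume.restrict (Set.Icc (0 : ℝ) 1)] f := by
  obtain ⟨μ, rfl⟩ := Nat.exists_eq_add_of_le' hm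
  obtain ⟨a, f₀, h, ha⟩ := BetaProduct.exists_isRep μ u v huv
  set δ := BetaProduct.delta u v with hδ
  have hδ0 : 0 < δ := BetaProduct.delta_pos huv
  have ha0 : 0 < a 0 := by
    rw [ha]
    have := Real.Gamma_pos_of_pos hδ0
    refine mul_pos (by positivity) (Finset.prod_pos fun i _ => div_pos ?_ ?_)
    · exact Real.Gamma_pos_of_pos ((huv i).1.trans (huv i).2)
    · exact Real.Gamma_pos_of_pos (huv i).1
  have hsum (x : ℝ) (hx : x ∈ Set.Ioc (0 : ℝ) 1) :
      Summable fun n : ℕ => a n / a 0 * (1 - x) ^ n := by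
    have hw : 0 ≤ 1 - x := by linarith [hx.2]
    refine (((h.summable (1 - x) ⟨hw, by linarith [hx.1]⟩).mul_left (a 0)⁻¹).of_norm_bounded
      fun n => ?_)
    rw [norm_mul, norm_div, norm_pow, Real.norm_of_nonneg hw, Real.norm_of_nonneg ha0.le,
      Real.norm_eq_abs]
    exact le_of_eq (by ring)
  have hsplit (x : ℝ) (hx : x ∈ Set.Ioc (0 : ℝ) 1) :
      1 + ∑' n : ℕ, a (n + 1) / a 0 * (1 - x) ^ (n + 1) = ∑' n : ℕ, a n / a 0 * (1 - x) ^ n := by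
    rw [(hsum x hx).tsum_eq_zero_add, pow_zero, mul_one, div_self ha0.ne']
  set F : ℝ → ℝ := fun x => 1 / Real.Gamma δ * (∏ i, Real.Gamma (v i) / Real.Gamma (u i))
      * (1 - x) ^ (δ - 1) * (1 + ∑' n : ℕ, a (n + 1) / a 0 * (1 - x) ^ (n + 1)) with hF
  have hFf (x : ℝ) (hx : x ∈ Set.Ioo (0 : ℝ) 1) : F x = f₀ x := by
    simp only [hF]
    rw [← ha, hsplit x ⟨hx.1, hx.2.le⟩, h.eq_tsum x hx, mul_right_comm, mul_comm, ← tsum_mul_left]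
    congr 2 with n
    field_simp
  -- The series may diverge at `x = 0`, so the value there is set to `0` to keep `f` nonnegative on
  -- the closed interval.
  set f : ℝ → ℝ := fun x => if x = 0 then 0 else F x with hf
  have hff (x : ℝ) (hx : x ∈ Set.Ioo (0 : ℝ) 1) : f x = f₀ x := by
    rw [hf, ← hFf x hx]
    exact if_neg hx.1.ne'
  have hint (n : ℕ) :
      ∫ x in (0 : ℝ)..1, x ^ n * f x = ∏ i, BetaProduct.poch (u i) n / BetaProduct.poch (v i) n := by
    rw [intervalIntegral.integral_of_le zero_le_one, integral_Ioc_eq_integral_Ioo,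
      setIntegral_congr_fun measurableSet_Ioo fun x hx => by rw [hff x hx], ← h.moment n]
    exact setIntegral_eq_integral_of_forall_compl_eq_zero fun x hx => by
      rw [h.eq_zero x hx, mul_zero]
  have hdens : BetaProduct.IsDensity f := by
    refine ⟨fun x hx => ?_, ?_, ?_⟩
    · rcases hx.1.eq_or_lt with h0 | h0
      · simp [hf, ← h0]
      rcases hx.2.eq_or_lt with h1 | h1
      -- At `x = 1` only the constant term of the series survives, and `0 ^ (δ - 1)` is nonnegative
      -- for every `δ`.
      · have h2 : F 1 = a 0 * 0 ^ (δ - 1) := by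
          simp [hF, ha]
        rw [h1, hf]
        simp only [one_ne_zero, if_false, h2]
        exact mul_nonneg ha0.le (Real.rpow_nonneg le_rfl _)
      · rw [hff x ⟨h0, h1⟩]
        exact h.nonneg x
    · rw [integrableOn_Icc_iff_integrableOn_Ioo]
      exact h.integrable.integrableOn.congr_fun (fun x hx => (hff x hx).symm) measurableSet_Ioo
    · simpa [BetaProduct.poch] using hint 0
  refine ⟨fun n => a n / a 0, h.isCoeffSeq huv ha0.ne', fun x hx =>
    (summable_nat_add_iff 1).2 (hsum x hx), f, hdens, hint, fun x hx _ => ?_,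
    fun g hg hgm => BetaProduct.ae_eq_of_hasMoments hdens hint hg hgm⟩
  exact if_neg hx.1.ne'
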